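/- \textbf{Setting.} Let $U$ be a unitary on a finite-dimensional Hilbert space $\mathcal H$ with a unit vector $|\psi_0\rangle$ that is, up to scalars, the unique eigenvector of eigenvalue $1$, and suppose that all other eigenvalues $e^{i\lambda_j}$, $\lambda_j\in(0,2\pi)$, satisfy $\Delta\le\lambda_j\le 2\pi-\Delta$. Let $R_{\psi_0}$ be the reflection with $R_{\psi_0}|\psi_0\rangle=|\psi_0\rangle$ and $R_{\psi_0}|\psi^\perp\rangle=-|\psi^\perp\rangle$ for $\psi^\perp\perp\psi_0$. Circuits act on ancillary qubits and on $\mathcal H$; they consist of exact one- and two-qubit gates on the ancillas (their number is the gate count) and of applications of $U$ or $U^\dagger$ controlled by an ancilla (their number is the query count). For integers $q,m,k$ let $B$ consist of $q$ approximate quantum Fourier transforms in parallel, one on each of $q$ registers of $m$ qubits; the approximate transform is the usual circuit of Hadamard gates, controlled rotations by $\pi/2^d$ between qubits at distance $d$, and bit reversal, without the rotations with $d>k$. Let $W$ be the $q$-fold phase estimation circuit: first $B$, then in each register, for $0\le j<m$, $2^j$ applications of $U$ controlled by the qubit of weight $2^j$, then $B^\dagger$. Let $R$ be a circuit of one- and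 two-qubit gates which, with workspace qubits starting and ending in $|0\rangle$, implements exactly $2|0\rangle\langle0|-\mathbb 1$ on the $qm$ register qubits. Put $A=W^\dagger RW$. \textbf{Claim.} For all constants $\eta>0$, $\varepsilon_0\in(0,1)$ and $\Delta_0\in(0,1/e)$ there is a constant $C$ such that for all $0<\epsilon\le\varepsilon_0$ and $0<\Delta\le\Delta_0$ there are $q\le C\log(1/\epsilon)$, $m\le C\log(1/\Delta)$, a cutoff $k$ and a circuit $R$ as above, all independent of $\mathcal H$, $U$ and $\psi_0$, such that: (1) each approximate Fourier transform is within $\eta$ in operator norm of the exact transform $|x\rangle\mapsto 2^{-m/2}\sum_y e^{2\pi i xy/2^m}|y\rangle$ and has at most $C\log(1/\Delta)\log\log(1/\Delta)$ gates, and $R$ has at most $C\,qm$ gates; (2) $A$ uses in total (registers and workspace) at most $C\log(1/\epsilon)\log(1/\Delta)$ ancillary qubits, at most $C\log(1/\epsilon)/\Delta$ queries, and at most $C\log(1/\epsilon)\log(1/\Delta)\log\log(1/\Delta)$ gates; (3) for all $\mathcal H$, $U$, $\psi_0$ as in the setting with this $\Delta$, $A|0\rangle|\psi_0\rangle=|0\rangle|\psi_0\rangle$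 exactly, and $\|A|0\rangle|\xi\rangle-|0\rangle R_{\psi_0}|\xi\rangle\|\le\epsilon$ for every unit vector $|\xi\rangle\in\mathcal H$. Moreover, the dependence on $\Delta$ of the gate count is an almost quadratic improvement over $\log^2(1/\Delta)$: for every $\delta>0$, $\log(1/\Delta)\log\log(1/\Delta)=o(\log^{1+\delta}(1/\Delta))$ as $\Delta\to0^+$. -/

import Mathlib

open Filter Topology Asymptotics

/-- Computational basis labels of a register whose qubits are indexed by `Q`. -/
abbrev Bits (Q : Type) : Type := Q → Bool

/-- Elementary operations of a circuit on a register of ancillary qubits `Q` and one system: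
one- and two-qubit gates on the ancillas (arbitrary, exact, independent of `U`), and the
`U`-queries, i.e. `U` or its inverse on the system, controlled by an ancillary qubit. -/
inductive Gate (Q : Type) : Type
  | one (i : Q) (G : Matrix.unitaryGroup Bool ℂ) : Gate Q
  | two (i j : Q) (hij : i ≠ j) (G : Matrix.unitaryGroup (Bool × Bool) ℂ) : Gate Q
  | query (c : Q) : Gate Q
  | queryInv (c : Q) : Gate Q

namespace Gate

variable {Q : Type}

/-- Action of a gate on the joint states of register and system. The joint space
`ℂ^(2^Q) ⊗ E` is written as `Bits Q → E`: the state `∑ b, |b⟩ ⊗ ψ b` is the function `ψ`. -/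
def apply [DecidableEq Q] {E : Type*} [NormedAddCommGroup E] [InnerProductSpace ℂ E]
    (U : E ≃ₗᵢ[ℂ] E) : Gate Q → (Bits Q → E) → (Bits Q → E)
  | one i G, ψ => fun b => ∑ x : Bool, G.1 (b i) x • ψ (Function.update b i x)
  | two i j _ G, ψ => fun b => ∑ x : Bool, ∑ y : Bool,
      G.1 (b i, b j) (x, y) • ψ (Function.update (Function.update b i x) j y)
  | query c, ψ => fun b => if b c then U (ψ b) else ψ b
  | queryInv c, ψ => fun b => if b c then U.symm (ψ b) else ψ b

/-- The inverse (adjoint) operation. -/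
def adjoint : Gate Q → Gate Q
  | one i G => one i G⁻¹
  | two i j hij G => two i j hij G⁻¹
  | query c => queryInv c
  | queryInv c => query c

/-- The same operation on relabelled qubits. -/
def map {Q' : Type} (f : Q ↪ Q') : Gate Q → Gate Q'
  | one i G => one (f i) G
  | two i j hij G => two (f i) (f j) (fun h => hij (f.injective h)) G
  | query c => query (f c)
  | queryInv c => queryInv (f c)

def isQuery : Gate Q → Bool
  | one _ _ => false
  | two _ _ _ _ => false
  | query _ => true
  | queryInv _ => true

end Gate

/-- A circuit: a list of operations, the first of which is applied first. -/
abbrev Circuit (Q : Type) : Type := List (Gate Q)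

namespace Circuit

variable {Q : Type}

def run [DecidableEq Q] {E : Type*} [NormedAddCommGroup E] [InnerProductSpace ℂ E]
    (U : E ≃ₗᵢ[ℂ] E) (A : Circuit Q) (ψ : Bits Q → E) : Bits Q → E :=
  A.foldl (fun φ g => g.apply U φ) ψ

/-- The inverse circuit. -/
def inv (A : Circuit Q) : Circuit Q := (A.map Gate.adjoint).reverse

/-- Number of uses of controlled `U` and controlled `U⁻¹`. -/
def queryCount (A : Circuit Q) : ℕ := A.countP fun g => g.isQuery

/-- Number of one- and two-qubit gates. -/
def gateCount (A : Circuit Q) : ℕ := A.countP fun g => !g.isQuery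

end Circuit

noncomputable section

section States

variable {Q : Type} [Fintype Q] {E : Type*} [NormedAddCommGroup E] [InnerProductSpace ℂ E]

/-- The Euclidean (Hilbert space) norm of a joint state of register and system. -/
def stateNorm [DecidableEq Q] (ψ : Bits Q → E) : ℝ :=
  ‖(WithLp.toLp 2 ψ : PiLp 2 (fun _ : Bits Q => E))‖

/-- The state `|0⟩ ⊗ ξ`, all qubits of the register being in the state `|0⟩`. -/
def zeroKet (Q : Type) [Fintype Q] (ξ : E) : Bits Q → E :=
  fun b => if ∀ i, b i = false then ξ else 0

/-- The operation `2|0⟩⟨0| - 1` on the qubits `Q`. -/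
def zeroReflection (φ : Bits Q → ℂ) : Bits Q → ℂ :=
  fun b => if ∀ i, b i = false then φ b else -φ b

/-- The state `φ ⊗ |0⟩` of a register `Q` together with a workspace `T`. -/
def withWorkspace {T : Type} [Fintype T] (φ : Bits Q → ℂ) : Bits (Q ⊕ T) → ℂ :=
  fun b => if ∀ t, b (Sum.inr t) = false then φ (fun i => b (Sum.inl i)) else 0

end States

/-- Hadamard gate. -/
def hadamardGate : Matrix.unitaryGroup Bool ℂ :=
  ⟨Matrix.of fun x y => (if x && y then -1 else 1) / (Real.sqrt 2 : ℂ), by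
    have h : ((Real.sqrt 2 : ℝ) : ℂ) * (Real.sqrt 2 : ℝ) = 2 := by
      rw [← Complex.ofReal_mul, Real.mul_self_sqrt (by norm_num)]; norm_num
    have h0 : ((Real.sqrt 2 : ℝ) : ℂ) ≠ 0 := by
      intro h'; rw [h'] at h; norm_num at h
    rw [Matrix.mem_unitaryGroup_iff]
    ext x y
    have h' : ((Real.sqrt 2 : ℝ) : ℂ) ^ 2 = 2 := by rw [pow_two, h]
    cases x <;> cases y <;>
      simp [Matrix.mul_apply, Matrix.star_apply] <;> field_simp <;> simp [h']
    norm_num⟩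

/-- Controlled phase gate: multiplies `|11⟩` by `exp (i θ)`. -/
def phaseGate (θ : ℝ) : Matrix.unitaryGroup (Bool × Bool) ℂ :=
  ⟨Matrix.diagonal fun x => if x.1 && x.2 then Complex.exp (θ * Complex.I) else 1, by
    rw [Matrix.mem_unitaryGroup_iff, Matrix.star_eq_conjTranspose,
      Matrix.diagonal_conjTranspose, Matrix.diagonal_mul_diagonal, ← Matrix.diagonal_one]
    congr 1
    funext x
    rcases x with ⟨x, y⟩
    cases x <;> cases y <;>
      simp [← Complex.exp_conj, ← Complex.exp_add]⟩

/-- Swap gate. -/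
def swapGate : Matrix.unitaryGroup (Bool × Bool) ℂ :=
  ⟨Matrix.of fun x y => if x.1 = y.2 ∧ x.2 = y.1 then 1 else 0, by
    rw [Matrix.mem_unitaryGroup_iff]
    ext x y
    rcases x with ⟨x, x'⟩
    rcases y with ⟨y, y'⟩
    cases x <;> cases x' <;> cases y <;> cases y' <;>
      simp [Matrix.mul_apply, Matrix.star_apply, Fintype.sum_prod_type]⟩

/-- The integer stored in an `m`-qubit register; qubit `j` is the binary digit of weight `2 ^ j`. -/
def bitsVal {m : ℕ} (b : Bits (Fin m)) : ℕ := ∑ j : Fin m, if b j then 2 ^ (j : ℕ) else 0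

/-- The exact quantum Fourier transform on `m` qubits,
`|x⟩ ↦ 2^(-m/2) ∑ y, exp (2 π i x y / 2^m) |y⟩`. -/
def qft (m : ℕ) (φ : Bits (Fin m) → ℂ) : Bits (Fin m) → ℂ := fun y =>
  ∑ x : Bits (Fin m),
    (Complex.exp (2 * Real.pi * Complex.I * (bitsVal x * bitsVal y : ℕ) / (2 ^ m : ℕ)) /
      (Real.sqrt (2 ^ m) : ℂ)) * φ x

/-- The approximate quantum Fourier transform circuit with cutoff `k`: the usual circuit of
Hadamard gates, controlled rotations by `π / 2 ^ d` between qubits at distance `d`, and final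
bit reversal, from which all rotations with `d > k` are left out. -/
def aqft (m k : ℕ) : Circuit (Fin m) :=
  ((List.finRange m).reverse.flatMap fun j : Fin m =>
    Gate.one j hadamardGate ::
      (List.finRange m).flatMap fun i : Fin m =>
        if h : i < j ∧ (j : ℕ) - i ≤ k then
          [Gate.two j i h.1.ne' (phaseGate (Real.pi / 2 ^ ((j : ℕ) - i)))]
        else []) ++
  (List.finRange m).flatMap fun i : Fin m =>
    if h : i < i.rev then [Gate.two i i.rev h.ne swapGate] else []

/-- The circuit `aqft m k` is within `η` of the quantum Fourier transform in operator norm. It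
contains no queries, so it is run here with the trivial system `ℂ`. -/
def AqftPrecision (m k : ℕ) (η : ℝ) : Prop :=
  ∀ φ : Bits (Fin m) → ℂ,
    stateNorm ((aqft m k).run (LinearIsometryEquiv.refl ℂ ℂ) φ - qft m φ) ≤ η * stateNorm φ

/-- Ancillas: `q` phase estimation registers of `m` qubits each, and `e` workspace qubits. -/
abbrev PeaQubits (q m e : ℕ) : Type := (Fin q × Fin m) ⊕ Fin e

/-- Inclusion of the `r`-th phase estimation register into the ancillas. -/
def peaRegister {q m e : ℕ} (r : Fin q) : Fin m ↪ PeaQubits q m e :=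
  ⟨fun j => Sum.inl (r, j), fun i j h => by simpa using h⟩

/-- `q` approximate quantum Fourier transforms in parallel, one on each register. -/
def parallelAqft (q m k e : ℕ) : Circuit (PeaQubits q m e) :=
  (List.finRange q).flatMap fun r => (aqft m k).map (Gate.map (peaRegister r))

/-- In each register, qubit `j` controls `U ^ (2 ^ j)` (i.e. `2 ^ j` queries), so that
`|x⟩ ⊗ ξ ↦ |x⟩ ⊗ U ^ x ξ`. -/
def controlledPowers (q m e : ℕ) : Circuit (PeaQubits q m e) :=
  (List.finRange q).flatMap fun r =>
    (List.finRange m).flatMap fun j : Fin m =>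
      List.replicate (2 ^ (j : ℕ)) (Gate.query (peaRegister r j))

/-- The phase estimation circuit `W`: Fourier transforms, controlled powers of `U`, inverse
Fourier transforms. -/
def peaCircuit (q m k e : ℕ) : Circuit (PeaQubits q m e) :=
  parallelAqft q m k e ++ controlledPowers q m e ++ (parallelAqft q m k e).inv

/-- `R` is built from one- and two-qubit gates only, and implements exactly the reflection
`2|0⟩⟨0| - 1` on the phase estimation registers, the workspace starting and ending in `|0⟩`. -/
def ImplementsZeroReflection {q m e : ℕ} (R : Circuit (PeaQubits q m e)) : Prop :=
  R.queryCount = 0 ∧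
  ∀ φ : Bits (Fin q × Fin m) → ℂ,
    R.run (LinearIsometryEquiv.refl ℂ ℂ) (withWorkspace φ) = withWorkspace (zeroReflection φ)

/-- The circuit `W`, then `R`, then `W⁻¹`. -/
def peaReflection {q m e : ℕ} (k : ℕ) (R : Circuit (PeaQubits q m e)) :
    Circuit (PeaQubits q m e) :=
  peaCircuit q m k e ++ R ++ (peaCircuit q m k e).inv

/-- `ψ₀` is a unit vector, it is (up to scalars) the unique eigenvector of `U` of eigenvalue `1`,
and all other eigenphases of `U` in `(0, 2π)` lie in `[Δ, 2π - Δ]`. -/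
def IsGappedTarget {E : Type*} [NormedAddCommGroup E] [InnerProductSpace ℂ E]
    (U : E ≃ₗᵢ[ℂ] E) (ψ₀ : E) (Δ : ℝ) : Prop :=
  ‖ψ₀‖ = 1 ∧
  (∀ v : E, U v = v ↔ v ∈ Submodule.span ℂ {ψ₀}) ∧
  ∀ θ : ℝ, 0 < θ → θ < 2 * Real.pi →
    Module.End.HasEigenvalue (U.toLinearEquiv.toLinearMap : Module.End ℂ E)
      (Complex.exp (θ * Complex.I)) →
    Δ ≤ θ ∧ θ ≤ 2 * Real.pi - Δ

end

/-! Let `P(z)` be the `q`-th power of `∏_{j<m} (1 + z^(2^j)) / 2`. The Fourier transform circuit,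
with any cutoff, sends `|0⟩` exactly to the uniform superposition: the rotations are trivial on
`|0⟩`. Hence `⟨0|W|0⟩` is the average of `U^x` over all register contents, which is `P(U)`
(`run_peaCircuit_zeroKet_apply_zero`, `powerAverage_eq_aeval`). The cutoff error never enters the
correctness of the reflection; it matters only for the separate precision requirement.

Since `R` acts as `2|0⟩⟨0| - 1`, one gets `A|0⟩ξ = 2 W†(|0⟩ P(U)ξ) - |0⟩ξ`. Write `ξ = p + η` with
`p` in the span of `ψ₀` and `η` orthogonal to it. Both `P(U)` and `W` fix the contribution of `p`,
so the target case is exact and the error for general `ξ` is `2 W†(|0⟩ P(U)η)`, of norm `2‖P(U)η‖`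
because circuits are unitary.

On the orthogonal complement every eigenvalue `z = e^{iθ}` satisfies `|z - 1| ≥ 2Δ/π`. The
telescoping identity `(z - 1) ∏ (1 + z^(2^j)) = z^(2^m) - 1` bounds one register's factor by `π / (Δ
2^m) ≤ 1/2` once `2^m ≥ 2π/Δ`. Thus `‖P(U)η‖ ≤ 2^(-q)‖η‖` (`norm_powerAverage_le`), and `2^q ≥ 2/ε`
suffices.

For the costs, the cutoff changes each of the `m` Fourier stages by a diagonal phase error of at
most `π/2^k`, so `k` of order `log m` gives precision `η` with `O(mk)` gates. The reflection is a
chain of reversible logical steps, linear in `qm`, which is computed, used for a sign, and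
uncomputed. -/

set_option linter.unusedSectionVars false

/-! ### Linearity and invertibility of circuits. -/

section GateAlgebra

variable {Q : Type} [DecidableEq Q] {E : Type*} [NormedAddCommGroup E] [InnerProductSpace ℂ E]
  (U : E ≃ₗᵢ[ℂ] E)

theorem Gate.isLinearMap_apply (g : Gate Q) :
    IsLinearMap ℂ (g.apply U : (Bits Q → E) → (Bits Q → E)) := by
  constructor
  · intro ψ φ
    funext b
    cases g <;> simp only [Gate.apply, Pi.add_apply, smul_add, Finset.sum_add_distrib] <;>
      split_ifs <;> simp
  · intro c ψ
    funext b
    cases g <;> simp only [Gate.apply, Pi.smul_apply, Finset.smul_sum, smul_comm c] <;>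
      split_ifs <;> simp

namespace Circuit

@[simp] theorem run_nil (ψ : Bits Q → E) : Circuit.run U ([] : Circuit Q) ψ = ψ := rfl

@[simp] theorem run_cons (g : Gate Q) (A : Circuit Q) (ψ : Bits Q → E) :
    Circuit.run U (g :: A) ψ = A.run U (g.apply U ψ) := rfl

theorem run_append (A B : Circuit Q) (ψ : Bits Q → E) :
    Circuit.run U (A ++ B) ψ = B.run U (A.run U ψ) := by
  simp [Circuit.run]

theorem isLinearMap_run (A : Circuit Q) :
    IsLinearMap ℂ (A.run U : (Bits Q → E) → (Bits Q → E)) := by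
  induction A with
  | nil => exact ⟨fun _ _ => rfl, fun _ _ => rfl⟩
  | cons g A ih =>
    refine ⟨fun ψ φ => ?_, fun c ψ => ?_⟩
    · simp only [run_cons, (g.isLinearMap_apply U).map_add, ih.map_add]
    · simp only [run_cons, (g.isLinearMap_apply U).map_smul, ih.map_smul]

end Circuit

theorem update_update_update_update {Q : Type} [DecidableEq Q] {i j : Q} (hij : i ≠ j)
    (b : Bits Q) (x y x' y' : Bool) :
    Function.update (Function.update (Function.update (Function.update b i x) j y) i x') j y' =
      Function.update (Function.update b i x') j y' := by
  funext t
  by_cases hj : t = j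
  · subst hj; simp
  · by_cases hi : t = i
    · subst hi; simp [hj]
    · simp [hi, hj]

theorem Bool.sum_sum_eq {M : Type*} [AddCommMonoid M] (F : Bool → Bool → M) :
    ∑ x, ∑ y, F x y = ∑ p : Bool × Bool, F p.1 p.2 := by
  rw [Fintype.sum_prod_type]

theorem Gate.apply_adjoint_apply (g : Gate Q) (ψ : Bits Q → E) :
    g.adjoint.apply U (g.apply U ψ) = ψ := by
  funext b
  cases g with
  | one i G =>
    have h : ∀ y, ∑ x, (G⁻¹).1 (b i) x * G.1 x y = (1 : Matrix Bool Bool ℂ) (b i) y := by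
      intro y
      rw [← Matrix.mul_apply, ← Submonoid.coe_mul, inv_mul_cancel]; rfl
    simp only [Gate.adjoint, Gate.apply, Function.update_self, Function.update_idem,
      Finset.smul_sum, smul_smul]
    rw [Finset.sum_comm]
    simp only [← Finset.sum_smul, h, Matrix.one_apply, ite_smul, one_smul, zero_smul]
    simp
  | two i j hij G =>
    have h : ∀ y, ∑ x, (G⁻¹).1 (b i, b j) x * G.1 x y
        = (1 : Matrix (Bool × Bool) (Bool × Bool) ℂ) (b i, b j) y := by
      intro y
      rw [← Matrix.mul_apply, ← Submonoid.coe_mul, inv_mul_cancel]; rfl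
    simp only [Gate.adjoint, Gate.apply, Bool.sum_sum_eq]
    simp only [Function.update_self, Function.update_of_ne hij, update_update_update_update hij,
      Prod.mk.eta, Finset.smul_sum, smul_smul]
    rw [Finset.sum_comm]
    simp only [← Finset.sum_smul, h, Matrix.one_apply, ite_smul, one_smul, zero_smul]
    simp
  | query c => by_cases h : b c <;> simp [Gate.adjoint, Gate.apply, h]
  | queryInv c => by_cases h : b c <;> simp [Gate.adjoint, Gate.apply, h]

theorem Circuit.inv_run_run (A : Circuit Q) (ψ : Bits Q → E) :
    A.inv.run U (A.run U ψ) = ψ := by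
  induction A generalizing ψ with
  | nil => rfl
  | cons g A ih =>
    have : Circuit.inv (g :: A) = Circuit.inv A ++ [g.adjoint] := by simp [Circuit.inv]
    rw [this, Circuit.run_append, Circuit.run_cons U g A, ih]
    exact g.apply_adjoint_apply U ψ

end GateAlgebra

/-! ### Adjoints and unitarity. -/

section Inner

variable {Q : Type} [DecidableEq Q] [Fintype Q] {E : Type*} [NormedAddCommGroup E]
  [InnerProductSpace ℂ E] (U : E ≃ₗᵢ[ℂ] E)

/-- The inner product of two joint states. -/
noncomputable def stateInner (ψ φ : Bits Q → E) : ℂ := ∑ b, inner ℂ (ψ b) (φ b)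

theorem stateNorm_sq (ψ : Bits Q → E) : stateNorm ψ ^ 2 = ∑ b, ‖ψ b‖ ^ 2 := by
  rw [stateNorm, PiLp.norm_sq_eq_of_L2]

theorem stateInner_self (ψ : Bits Q → E) : stateInner ψ ψ = (stateNorm ψ : ℂ) ^ 2 := by
  rw [← Complex.ofReal_pow, stateNorm_sq, stateInner]
  push_cast
  exact Finset.sum_congr rfl fun b _ => inner_self_eq_norm_sq_to_K _

theorem Gate.stateInner_apply (g : Gate Q) (ψ φ : Bits Q → E) :
    stateInner (g.apply U ψ) φ = stateInner ψ (g.adjoint.apply U φ) := by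
  unfold stateInner
  cases g with
  | one i G =>
    simp only [Gate.adjoint, Gate.apply, sum_inner, inner_sum, inner_smul_left, inner_smul_right,
      ← Fintype.sum_prod_type' (f := fun (b : Bits Q) (x : Bool) => _ * _)]
    -- Exchanging the stored bit with the summed bit is an involution that turns matrix entries into
    -- those of the adjoint.
    let e : Bits Q × Bool → Bits Q × Bool := fun p => (Function.update p.1 i p.2, p.1 i)
    have he : Function.Involutive e := fun p => by simp [e]
    refine Fintype.sum_equiv (Function.Involutive.toPerm e he) _ _ fun p => ?_
    simp [e, Function.Involutive.toPerm, Matrix.UnitaryGroup.inv_val, Matrix.star_apply]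
  | two i j hij G =>
    simp only [Gate.adjoint, Gate.apply, sum_inner, inner_sum, inner_smul_left, inner_smul_right,
      Bool.sum_sum_eq,
      ← Fintype.sum_prod_type' (f := fun (b : Bits Q) (x : Bool × Bool) => _ * _)]
    let e : Bits Q × (Bool × Bool) → Bits Q × (Bool × Bool) := fun p =>
      (Function.update (Function.update p.1 i p.2.1) j p.2.2, (p.1 i, p.1 j))
    have he : Function.Involutive e := fun p => by
      simp only [e, Function.update_self, Function.update_of_ne hij, Prod.mk.eta]
      rw [update_update_update_update hij]
      simp
    refine Fintype.sum_equiv (Function.Involutive.toPerm e he) _ _ fun p => ?_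
    have h1 : Function.Involutive.toPerm e he p = e p := rfl
    have h3 : (e p).1 i = p.2.1 := by simp [e, Function.update_of_ne hij]
    have h4 : (e p).1 j = p.2.2 := by simp [e]
    have h5 := congrArg Prod.fst (he p)
    have h6 : Function.update (Function.update (e p).1 i (e p).2.1) j (e p).2.2 = p.1 := h5
    rw [h1, h3, h4, h6]
    simp [e, Matrix.UnitaryGroup.inv_val, Matrix.star_apply]
  | query c =>
    refine Finset.sum_congr rfl fun b _ => ?_
    by_cases h : b c
    · simp [Gate.adjoint, Gate.apply, h, ← U.inner_map_map (ψ b)]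
    · simp [Gate.adjoint, Gate.apply, h]
  | queryInv c =>
    refine Finset.sum_congr rfl fun b _ => ?_
    by_cases h : b c
    · simp [Gate.adjoint, Gate.apply, h, ← U.inner_map_map (U.symm (ψ b))]
    · simp [Gate.adjoint, Gate.apply, h]

theorem Circuit.stateInner_run (A : Circuit Q) (ψ φ : Bits Q → E) :
    stateInner (A.run U ψ) φ = stateInner ψ (A.inv.run U φ) := by
  induction A generalizing ψ φ with
  | nil => rfl
  | cons g A ih =>
    have : Circuit.inv (g :: A) = Circuit.inv A ++ [g.adjoint] := by simp [Circuit.inv]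
    rw [this, Circuit.run_append, Circuit.run_cons, ih, g.stateInner_apply]
    rfl

theorem Circuit.stateNorm_run (A : Circuit Q) (ψ : Bits Q → E) :
    stateNorm (A.run U ψ) = stateNorm ψ := by
  have h := A.stateInner_run U ψ (A.run U ψ)
  rw [A.inv_run_run, stateInner_self, stateInner_self] at h
  have h' : stateNorm (A.run U ψ) ^ 2 = stateNorm ψ ^ 2 := by exact_mod_cast h
  exact (pow_left_inj₀ (norm_nonneg _) (norm_nonneg _) two_ne_zero).1 h'

end Inner

/-! ### Circuits acting on part of a register. -/

section Relabel

variable {Q Q' : Type} [DecidableEq Q] [DecidableEq Q'] {E : Type*} [NormedAddCommGroup E]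
  [InnerProductSpace ℂ E] (U : E ≃ₗᵢ[ℂ] E) (f : Q ↪ Q')

theorem update_extend (c : Bits Q) (b₀ : Bits Q') (i : Q) (x : Bool) :
    Function.update (Function.extend f c b₀) (f i) x =
      Function.extend f (Function.update c i x) b₀ := by
  funext t
  by_cases ht : ∃ s, f s = t
  · obtain ⟨s, rfl⟩ := ht
    by_cases hs : s = i
    · subst hs; simp [f.injective.extend_apply]
    · simp [f.injective.extend_apply, hs, f.injective.ne hs]
  · have : t ≠ f i := fun h => ht ⟨i, h.symm⟩
    rw [Function.update_of_ne this, Function.extend_apply' _ _ _ ht, Function.extend_apply' _ _ _ ht]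

/-- A relabelled gate acts on the relabelled qubits only. -/
theorem Gate.apply_map (g : Gate Q) (ψ : Bits Q' → E) (c : Bits Q) (b₀ : Bits Q') :
    (g.map f).apply U ψ (Function.extend f c b₀) =
      g.apply U (fun c => ψ (Function.extend f c b₀)) c := by
  cases g <;> simp only [Gate.map, Gate.apply, f.injective.extend_apply, update_extend]

/-- The spectator bits `b₀` are never touched, so the circuit acts separately on each slice with
`b₀` fixed. By `extend_comp_self` the slices cover all configurations. -/
theorem Circuit.run_map (A : Circuit Q) (ψ : Bits Q' → E) (c : Bits Q) (b₀ : Bits Q') :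
    Circuit.run U (A.map (Gate.map f)) ψ (Function.extend f c b₀) =
      A.run U (fun c => ψ (Function.extend f c b₀)) c := by
  induction A generalizing ψ with
  | nil => rfl
  | cons g A ih =>
    rw [List.map_cons, Circuit.run_cons, Circuit.run_cons, ih]
    congr 1
    funext c
    exact g.apply_map U f ψ c b₀

theorem extend_comp_self (b : Bits Q') : Function.extend f (fun i => b (f i)) b = b := by
  funext t
  by_cases ht : ∃ s, f s = t
  · obtain ⟨s, rfl⟩ := ht
    rw [f.injective.extend_apply]
  · rw [Function.extend_apply' _ _ _ ht]

end Relabel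

/-! ### Amplitudes of the Fourier transform circuit. -/

section Fourier

variable {Q : Type} [DecidableEq Q] {E : Type*} [NormedAddCommGroup E] [InnerProductSpace ℂ E]
  (U : E ≃ₗᵢ[ℂ] E)

theorem apply_phaseGate {i j : Q} (hij : i ≠ j) (θ : ℝ) (ψ : Bits Q → E) (b : Bits Q) :
    (Gate.two i j hij (phaseGate θ)).apply U ψ b =
      Complex.exp ((if b i && b j then θ else 0 : ℝ) * Complex.I) • ψ b := by
  simp only [Gate.apply, Bool.sum_sum_eq, phaseGate, Matrix.diagonal_apply, ite_smul, zero_smul,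
    Prod.mk.eta, Finset.sum_ite_eq, Finset.mem_univ, if_true]
  simp only [Function.update_eq_self]
  split_ifs <;> simp

theorem apply_swapGate {i j : Q} (hij : i ≠ j) (ψ : Bits Q → E) (b : Bits Q) :
    (Gate.two i j hij swapGate).apply U ψ b =
      ψ (Function.update (Function.update b i (b j)) j (b i)) := by
  simp only [Gate.apply, swapGate, Matrix.of_apply]
  cases b i <;> cases b j <;> simp

/-- The controlled rotations with target `j`. -/
noncomputable def phaseLadder (m k : ℕ) (j : Fin m) (l : List (Fin m)) : Circuit (Fin m) :=
  l.flatMap fun i : Fin m =>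
    if h : i < j ∧ (j : ℕ) - i ≤ k then
      [Gate.two j i h.1.ne' (phaseGate (Real.pi / 2 ^ ((j : ℕ) - i)))]
    else []

/-- The stage of the Fourier transform circuit that belongs to qubit `j`. -/
noncomputable def fourierStage (m k : ℕ) (j : Fin m) : Circuit (Fin m) :=
  Gate.one j hadamardGate :: phaseLadder m k j (List.finRange m)

/-- The final bit reversal, restricted to a list of qubits. -/
noncomputable def reversalSwaps (m : ℕ) (l : List (Fin m)) : Circuit (Fin m) :=
  l.flatMap fun i : Fin m =>
    if h : i < i.rev then [Gate.two i i.rev h.ne swapGate] else []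

theorem aqft_eq (m k : ℕ) : aqft m k =
    (List.finRange m).reverse.flatMap (fourierStage m k) ++ reversalSwaps m (List.finRange m) :=
  rfl

theorem run_phaseLadder {m : ℕ} (k : ℕ) (j : Fin m) (l : List (Fin m)) (ψ : Bits (Fin m) → E)
    (b : Bits (Fin m)) :
    (phaseLadder m k j l).run U ψ b =
      Complex.exp ((l.map fun i => if (i < j ∧ (j : ℕ) - i ≤ k) ∧ b j ∧ b i then
        Real.pi / 2 ^ ((j : ℕ) - i) else 0).sum * Complex.I) • ψ b := by
  induction l generalizing ψ with
  | nil => simp [phaseLadder]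
  | cons a l ih =>
    have : phaseLadder m k j (a :: l) = (if h : a < j ∧ (j : ℕ) - a ≤ k then
      [Gate.two j a h.1.ne' (phaseGate (Real.pi / 2 ^ ((j : ℕ) - a)))] else []) ++
        phaseLadder m k j l := rfl
    rw [this, Circuit.run_append, ih, List.map_cons, List.sum_cons]
    by_cases h : a < j ∧ (j : ℕ) - a ≤ k
    · rw [dif_pos h, Circuit.run_cons, Circuit.run_nil, apply_phaseGate, smul_smul,
        ← Complex.exp_add]
      simp only [h, true_and, and_self, Bool.and_eq_true]
      congr 2
      push_cast
      ring
    · rw [dif_neg h, Circuit.run_nil, if_neg fun h' => h h'.1, zero_add]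

/-- Each pair is swapped at its smaller member only, and `Nodup` prevents a second swap. The two
alternatives say that this smaller member is `i` or `i.rev`. -/
theorem run_reversalSwaps {m : ℕ} (l : List (Fin m)) (hl : l.Nodup) (ψ : Bits (Fin m) → E)
    (b : Bits (Fin m)) :
    (reversalSwaps m l).run U ψ b =
      ψ (fun i => if (i ∈ l ∧ i < i.rev) ∨ (i.rev ∈ l ∧ i.rev < i) then b i.rev else b i) := by
  induction l generalizing ψ with
  | nil => simp [reversalSwaps]
  | cons a l ih =>
    have : reversalSwaps m (a :: l) = (if h : a < a.rev then
      [Gate.two a a.rev h.ne swapGate] else []) ++ reversalSwaps m l := rfl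
    rw [this, Circuit.run_append, ih (List.nodup_cons.1 hl).2]
    have ha := (List.nodup_cons.1 hl).1
    by_cases h : a < a.rev
    · rw [dif_pos h, Circuit.run_cons, Circuit.run_nil, apply_swapGate]
      congr 1
      funext i
      have hlt := h.not_gt
      by_cases h1 : i = a.rev
      · subst h1
        simp [ha, h, hlt]
      · by_cases h2 : i = a
        · subst h2
          simp [ha, h, hlt, h1]
        · have h3 : i.rev ≠ a := fun h' => h1 (by rw [← h', Fin.rev_rev])
          simp [h1, h2, h3]
    · rw [dif_neg h, Circuit.run_nil]
      congr 1
      funext i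
      have : ∀ i, (i ∈ a :: l ∧ i < i.rev) ↔ (i ∈ l ∧ i < i.rev) := fun i => by
        constructor
        · rintro ⟨hi, h'⟩
          rcases List.mem_cons.1 hi with rfl | hi
          · exact absurd h' h
          · exact ⟨hi, h'⟩
        · exact fun ⟨hi, h'⟩ => ⟨List.mem_cons_of_mem _ hi, h'⟩
      have h2 := this i.rev
      rw [Fin.rev_rev] at h2
      simp only [this, h2]

theorem run_reversalSwaps_finRange {m : ℕ} (ψ : Bits (Fin m) → E) (b : Bits (Fin m)) :
    (reversalSwaps m (List.finRange m)).run U ψ b = ψ (fun i => b i.rev) := by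
  rw [run_reversalSwaps U _ (List.nodup_finRange m)]
  congr 1
  funext i
  rcases lt_trichotomy i i.rev with h | h | h
  · simp [h]
  · simp [← h]
  · simp [h]

/-- The angle by which the circuit with cutoff `k` rotates when input bit `i` and output bit `j`
(before bit reversal) are set. -/
noncomputable def fourierAngle (k i j : ℕ) : ℝ :=
  if i ≤ j ∧ j - i ≤ k then Real.pi / 2 ^ (j - i) else 0

theorem sum_bits_succ {M : Type*} [AddCommMonoid M] {m : ℕ} (F : Bits (Fin (m + 1)) → M) :
    ∑ x, F x = ∑ c : Bits (Fin m), ∑ t : Bool, F (Fin.snoc (α := fun _ => Bool) c t) := by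
  rw [← (Fin.snocEquiv fun _ : Fin (m + 1) => Bool).sum_comp, Fintype.sum_prod_type,
    Finset.sum_comm]
  rfl

/-- The top qubit is treated first, and later stages never touch it; this is the recursion behind
`run_fourierStages`. -/
theorem fourierStages_succ (m k : ℕ) :
    (List.finRange (m + 1)).reverse.flatMap (fourierStage (m + 1) k) =
      fourierStage (m + 1) k (Fin.last m) ++
        ((List.finRange m).reverse.flatMap (fourierStage m k)).map (Gate.map Fin.castSuccEmb) := by
  rw [List.finRange_succ_last, List.reverse_append, ← List.map_reverse, List.flatMap_append,
    List.flatMap_map, List.map_flatMap]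
  congr 1
  · simp
  · congr 1
    funext j
    simp only [fourierStage, List.map_cons, Gate.map, Fin.coe_castSuccEmb, phaseLadder,
      List.map_flatMap]
    congr 1
    rw [List.finRange_succ_last, List.flatMap_append, List.flatMap_map]
    simp only [List.flatMap_cons, List.flatMap_nil, List.append_nil]
    rw [dif_neg (fun h => absurd h.1 (Fin.le_last _).not_gt), List.append_nil]
    congr 1
    funext i
    by_cases h : i < j ∧ (j : ℕ) - i ≤ k
    · rw [dif_pos h, dif_pos (by simpa using h)]
      rfl
    · rw [dif_neg h, dif_neg (by simpa using h)]
      rfl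

/-- When stage `j` runs, the qubits below `j` still hold their input bits, while qubit `j` passes
from `x j` to `y j` in the Hadamard gate and keeps that value. So each path from `x` to `y` has one
amplitude, whose phase is a sum over pairs `i ≤ j`. -/
theorem run_fourierStages {m : ℕ} (k : ℕ) (ψ : Bits (Fin m) → E) (y : Bits (Fin m)) :
    Circuit.run U ((List.finRange m).reverse.flatMap (fourierStage m k)) ψ y =
      ∑ x : Bits (Fin m), ((1 / (Real.sqrt 2 : ℂ)) ^ m *
        Complex.exp ((∑ j : Fin m, ∑ i : Fin m,
          if y j ∧ x i then fourierAngle k i j else 0 : ℝ) * Complex.I)) • ψ x := by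
  induction m with
  | zero => 
    rw [Fintype.sum_unique, Subsingleton.elim y default, List.finRange_zero]
    simp only [List.reverse_nil, List.flatMap_nil, Circuit.run_nil, Finset.univ_eq_empty,
      Finset.sum_empty, pow_zero, Complex.ofReal_zero, zero_mul, Complex.exp_zero, mul_one,
      one_smul]
    exact congrArg ψ (Subsingleton.elim _ _)
  | succ m ih =>
    rw [fourierStages_succ, Circuit.run_append]
    conv_lhs => rw [← extend_comp_self Fin.castSuccEmb y]
    rw [Circuit.run_map, ih, sum_bits_succ]
    refine Finset.sum_congr rfl fun c _ => ?_
    have hext : Function.extend (Fin.castSuccEmb : Fin m ↪ Fin (m+1)) c y =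
        Fin.snoc (α := fun _ => Bool) c (y (Fin.last m)) := by
      funext t
      refine Fin.lastCases ?_ (fun t => ?_) t
      · rw [Function.extend_apply' _ _ _ (by simp), Fin.snoc_last]
      · rw [Fin.snoc_castSucc]
        exact Fin.castSuccEmb.injective.extend_apply c y t
    rw [hext, fourierStage, Circuit.run_cons, run_phaseLadder, smul_smul]
    simp only [Gate.apply, Finset.smul_sum, Fin.snoc_last, Fin.update_snoc_last, smul_smul]
    refine Finset.sum_congr rfl fun t _ => ?_
    congr 1
    rw [← Fin.sum_univ_def]
    have hlast : (∑ j : Fin (m + 1), ∑ i : Fin (m + 1),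
        if y j ∧ (Fin.snoc c t : Bits (Fin (m + 1))) i then fourierAngle k i j else 0) =
        (∑ j : Fin m, ∑ i : Fin m,
          if y (Fin.castSuccEmb j) ∧ c i then fourierAngle k i j else 0) +
        ((∑ i : Fin (m + 1), if (i < Fin.last m ∧ ((Fin.last m : Fin (m + 1)) : ℕ) - i ≤ k) ∧
            y (Fin.last m) ∧ (Fin.snoc c (y (Fin.last m)) : Bits (Fin (m + 1))) i then
          Real.pi / 2 ^ (((Fin.last m : Fin (m + 1)) : ℕ) - i) else 0) +
          if y (Fin.last m) ∧ t then Real.pi else 0) := by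
      rw [Fin.sum_univ_castSucc]
      congr 1
      · refine Finset.sum_congr rfl fun j _ => ?_
        rw [Fin.sum_univ_castSucc]
        simp [fourierAngle, j.2.not_ge]
      · rw [Fin.sum_univ_castSucc, Fin.sum_univ_castSucc]
        simp only [Fin.snoc_castSucc, Fin.snoc_last, Fin.val_castSucc, Fin.val_last,
          lt_self_iff_false, false_and, if_false, add_zero, fourierAngle, Fin.castSucc_lt_last,
          true_and]
        congr 1
        · refine Finset.sum_congr rfl fun i _ => ?_
          have := i.2.le
          by_cases h : m - (i : ℕ) ≤ k <;> simp [h, this]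
        · simp
    -- The Hadamard sign is the angle `π`, which is the diagonal case `i = j` of `fourierAngle`.
    have hH : hadamardGate.1 (y (Fin.last m)) t = (1 / (Real.sqrt 2 : ℂ)) *
        Complex.exp ((if y (Fin.last m) ∧ t then Real.pi else 0 : ℝ) * Complex.I) := by
      cases y (Fin.last m) <;> cases t <;> simp [hadamardGate, neg_div]
    rw [hlast, hH]
    push_cast
    rw [add_mul, add_mul, Complex.exp_add, Complex.exp_add, pow_succ]
    ring

/-- Amplitudes of the approximate quantum Fourier transform. -/
theorem run_aqft (m k : ℕ) (ψ : Bits (Fin m) → E) (y : Bits (Fin m)) :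
    (aqft m k).run U ψ y =
      ∑ x : Bits (Fin m), ((1 / (Real.sqrt 2 : ℂ)) ^ m *
        Complex.exp ((∑ j : Fin m, ∑ i : Fin m,
          if y j.rev ∧ x i then fourierAngle k i j else 0 : ℝ) * Complex.I)) • ψ x := by
  rw [aqft_eq, Circuit.run_append, run_reversalSwaps_finRange, run_fourierStages]

/-- The approximate Fourier transform maps `|0⟩` exactly to the uniform superposition. -/
theorem run_aqft_zeroKet (m k : ℕ) (ξ : E) (y : Bits (Fin m)) :
    (aqft m k).run U (zeroKet (Fin m) ξ) y = (1 / (Real.sqrt 2 : ℂ)) ^ m • ξ := by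
  rw [run_aqft, Finset.sum_eq_single (fun _ => false)]
  · simp [zeroKet]
  · intro x _ hx
    rw [zeroKet, if_neg (fun h => hx (funext h)), smul_zero]
  · simp

/-- Since `j.rev = m - 1 - j`, the exponent is `2πi · 2^(i-j-1)`: an integer multiple of `2πi` for
`i > j`, and `iπ/2^(j-i)` otherwise. -/
theorem exp_fourierAngle {m k : ℕ} (hk : m ≤ k) (i j : Fin m) :
    Complex.exp ((fourierAngle k i j : ℝ) * Complex.I) =
      Complex.exp (2 * Real.pi * Complex.I * (2 ^ (i : ℕ) * 2 ^ (j.rev : ℕ)) / 2 ^ m) := by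
  have hj : (j.rev : ℕ) + j + 1 = m := by rw [Fin.val_rev]; omega
  have hm : (2 : ℂ) ^ m = 2 ^ (j.rev : ℕ) * 2 ^ (j : ℕ) * 2 := by
    rw [← pow_add, ← pow_succ, hj]
  rcases le_or_gt (i : ℕ) j with h | h
  · have h1 : (j : ℕ) - i ≤ k := by omega
    rw [fourierAngle, if_pos ⟨h, h1⟩]
    congr 1
    obtain ⟨d, hd⟩ := Nat.exists_eq_add_of_le h
    rw [hm, hd, Nat.add_sub_cancel_left, pow_add]
    push_cast
    field_simp
  · rw [fourierAngle, if_neg (fun h' => absurd h'.1 h.not_ge)]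
    obtain ⟨d, hd⟩ := Nat.exists_eq_add_of_lt h
    rw [hm, hd, pow_add, pow_add]
    rw [Complex.ofReal_zero, zero_mul, Complex.exp_zero]
    symm
    rw [Complex.exp_eq_one_iff]
    refine ⟨2 ^ d, ?_⟩
    push_cast
    field_simp

/-- Without cutoff, the circuit is the quantum Fourier transform. -/
theorem run_aqft_eq_qft (V : ℂ ≃ₗᵢ[ℂ] ℂ) {m k : ℕ} (hk : m ≤ k) (φ : Bits (Fin m) → ℂ) :
    (aqft m k).run V φ = qft m φ := by
  funext y
  rw [run_aqft, qft]
  refine Finset.sum_congr rfl fun x _ => ?_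
  rw [smul_eq_mul]
  congr 1
  have hs : (Real.sqrt (2 ^ m) : ℂ) = (Real.sqrt 2 : ℂ) ^ m := by
    rw [← Complex.ofReal_pow]
    congr 1
    rw [Real.sqrt_eq_iff_mul_self_eq (by positivity) (by positivity), ← mul_pow,
      Real.mul_self_sqrt zero_le_two]
  have he : 2 * Real.pi * Complex.I * (bitsVal x * bitsVal y : ℕ) / (2 ^ m : ℕ) =
      ∑ j : Fin m, ∑ i : Fin m, if y j.rev ∧ x i then
        2 * Real.pi * Complex.I * (2 ^ (i : ℕ) * 2 ^ (j.rev : ℕ)) / 2 ^ m else 0 := by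
    have hy : bitsVal y = ∑ j : Fin m, if y j.rev then 2 ^ (j.rev : ℕ) else 0 :=
      (Equiv.sum_comp Fin.revPerm fun j : Fin m => if y j then 2 ^ (j : ℕ) else 0).symm
    rw [hy, bitsVal, Finset.sum_mul_sum, Finset.sum_comm]
    push_cast
    rw [Finset.mul_sum, Finset.sum_div]
    refine Finset.sum_congr rfl fun j _ => ?_
    rw [Finset.mul_sum, Finset.sum_div]
    refine Finset.sum_congr rfl fun i _ => ?_
    by_cases h1 : y j.rev <;> by_cases h2 : x i <;> simp [h1, h2]
  rw [he, hs, Complex.exp_sum, Complex.ofReal_sum, Finset.sum_mul, Complex.exp_sum]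
  rw [div_eq_mul_inv _ ((Real.sqrt 2 : ℂ) ^ m), mul_comm, one_div, inv_pow]
  congr 1
  refine Finset.prod_congr rfl fun j _ => ?_
  rw [Complex.exp_sum, Complex.ofReal_sum, Finset.sum_mul, Complex.exp_sum]
  refine Finset.prod_congr rfl fun i _ => ?_
  split_ifs
  · exact exp_fourierAngle hk i j
  · simp
end Fourier

/-! ### Error of the cutoff. -/

section Precision

theorem stateNorm_le_of_forall_norm_le {Q : Type} [DecidableEq Q] [Fintype Q] {E : Type*}
    [NormedAddCommGroup E] [InnerProductSpace ℂ E] {ψ φ : Bits Q → E} {c : ℝ} (hc : 0 ≤ c)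
    (h : ∀ b, ‖ψ b‖ ≤ c * ‖φ b‖) : stateNorm ψ ≤ c * stateNorm φ := by
  refine le_of_sq_le_sq ?_ (mul_nonneg hc (norm_nonneg _))
  rw [mul_pow, stateNorm_sq, stateNorm_sq, Finset.mul_sum]
  refine Finset.sum_le_sum fun b _ => ?_
  rw [← mul_pow]
  exact pow_le_pow_left₀ (norm_nonneg _) (h b) 2

theorem stateNorm_add_le {Q : Type} [DecidableEq Q] [Fintype Q] {E : Type*}
    [NormedAddCommGroup E] [InnerProductSpace ℂ E] (ψ φ : Bits Q → E) :
    stateNorm (ψ + φ) ≤ stateNorm ψ + stateNorm φ := by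
  rw [stateNorm, WithLp.toLp_add]
  exact norm_add_le _ _

variable {E : Type*} [NormedAddCommGroup E] [InnerProductSpace ℂ E] (U : E ≃ₗᵢ[ℂ] E)

/-- Hybrid argument: replacing the blocks one at a time, the errors add up without growing because
all circuits preserve the norm. -/
theorem stateNorm_run_flatMap_sub_le {Q ι : Type} [DecidableEq Q] [Fintype Q] (l : List ι)
    (f g : ι → Circuit Q) {δ : ℝ}
    (h : ∀ a, ∀ φ : Bits Q → E, stateNorm ((f a).run U φ - (g a).run U φ) ≤ δ * stateNorm φ)
    (φ : Bits Q → E) :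
    stateNorm (Circuit.run U (l.flatMap f) φ - Circuit.run U (l.flatMap g) φ) ≤
      l.length * δ * stateNorm φ := by
  induction l generalizing φ with
  | nil => simp [stateNorm]
  | cons a l ih =>
    rw [List.flatMap_cons, List.flatMap_cons, Circuit.run_append, Circuit.run_append]
    have key : Circuit.run U (l.flatMap f) ((f a).run U φ) -
        Circuit.run U (l.flatMap g) ((g a).run U φ) =
        (Circuit.run U (l.flatMap f) ((f a).run U φ) - Circuit.run U (l.flatMap g) ((f a).run U φ))
        + Circuit.run U (l.flatMap g) ((f a).run U φ - (g a).run U φ) := by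
      rw [(Circuit.isLinearMap_run U _).map_sub]
      abel
    rw [key]
    refine (stateNorm_add_le _ _).trans ?_
    have h1 := ih ((f a).run U φ)
    rw [Circuit.stateNorm_run] at h1
    rw [Circuit.stateNorm_run, List.length_cons]
    have h2 := h a φ
    push_cast
    linarith

theorem norm_exp_mul_I_sub_exp_mul_I_le (x y : ℝ) :
    ‖Complex.exp (x * Complex.I) - Complex.exp (y * Complex.I)‖ ≤ |x - y| := by
  have h : Complex.exp (x * Complex.I) - Complex.exp (y * Complex.I) =
      Complex.exp (y * Complex.I) * (Complex.exp (Complex.I * (x - y : ℝ)) - 1) := by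
    rw [mul_sub, ← Complex.exp_add, mul_one]
    congr 2
    push_cast
    ring
  rw [h, norm_mul, Complex.norm_exp_ofReal_mul_I, one_mul]
  exact Real.norm_exp_I_mul_ofReal_sub_one_le

/-- This is part of the geometric tail `∑_{d > k} 2^(-d)`. -/
theorem sum_long_range_le (m k : ℕ) (j : Fin m) :
    ∑ i : Fin m, (if i < j ∧ k < (j : ℕ) - i then (1 : ℝ) / 2 ^ ((j : ℕ) - i) else 0) ≤
      1 / 2 ^ k := by
  have h1 : ∑ i : Fin m, (if i < j ∧ k < (j : ℕ) - i then (1 : ℝ) / 2 ^ ((j : ℕ) - i) else 0) =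
      ∑ i ∈ (Finset.range m).filter (fun i => i < (j : ℕ) ∧ k < (j : ℕ) - i),
        (1 : ℝ) / 2 ^ ((j : ℕ) - i) := by
    rw [Finset.sum_filter, ← Fin.sum_univ_eq_sum_range
      (fun i => if i < (j : ℕ) ∧ k < (j : ℕ) - i then (1 : ℝ) / 2 ^ ((j : ℕ) - i) else 0)]
    rfl
  rw [h1]
  have h2 : ∑ i ∈ (Finset.range m).filter (fun i => i < (j : ℕ) ∧ k < (j : ℕ) - i),
        (1 : ℝ) / 2 ^ ((j : ℕ) - i) ≤ ∑ i ∈ Finset.range ((j : ℕ) - k), (2 : ℝ) ^ i / 2 ^ (j : ℕ) := by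
    refine (Finset.sum_le_sum_of_subset_of_nonneg
      (t := Finset.range ((j : ℕ) - k)) ?_ fun _ _ _ => by positivity).trans ?_
    · intro i hi
      simp only [Finset.mem_filter, Finset.mem_range] at hi ⊢
      omega
    · refine Finset.sum_le_sum fun i hi => le_of_eq ?_
      have : i ≤ j := by have := Finset.mem_range.1 hi; omega
      rw [pow_sub₀ _ two_ne_zero this]
      field_simp
  refine h2.trans ?_
  rw [← Finset.sum_div, geom_sum_eq (by norm_num)]
  rcases le_total (j : ℕ) k with h | h
  · rw [Nat.sub_eq_zero_of_le h]
    simp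
  · rw [pow_sub₀ _ two_ne_zero h]
    rw [div_le_div_iff₀ (by positivity) (by positivity)]
    have : (0 : ℝ) < 2 ^ k := by positivity
    field_simp
    nlinarith

/-- After a common Hadamard gate the two stages are diagonal, so they can be compared entry by
entry. The chord between two phases is at most the difference of angles, here `π` times the
long-range tail. -/
theorem stateNorm_run_fourierStage_sub_le (m k : ℕ) (j : Fin m) (φ : Bits (Fin m) → E) :
    stateNorm ((fourierStage m k j).run U φ - (fourierStage m m j).run U φ) ≤
      Real.pi / 2 ^ k * stateNorm φ := by
  rw [fourierStage, fourierStage, Circuit.run_cons, Circuit.run_cons]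
  have hg := Circuit.stateNorm_run U [Gate.one j hadamardGate] φ
  rw [Circuit.run_cons, Circuit.run_nil] at hg
  rw [← hg]
  refine stateNorm_le_of_forall_norm_le (by positivity) fun b => ?_
  rw [Pi.sub_apply, run_phaseLadder, run_phaseLadder, ← sub_smul, norm_smul]
  refine mul_le_mul_of_nonneg_right ((norm_exp_mul_I_sub_exp_mul_I_le _ _).trans ?_) (norm_nonneg _)
  rw [← Fin.sum_univ_def, ← Fin.sum_univ_def, ← Finset.sum_sub_distrib]
  refine (Finset.abs_sum_le_sum_abs _ _).trans ?_
  rw [div_eq_mul_one_div]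
  refine le_trans ?_ (mul_le_mul_of_nonneg_left (sum_long_range_le m k j) Real.pi_pos.le)
  rw [Finset.mul_sum]
  refine Finset.sum_le_sum fun i _ => ?_
  have hm : (j : ℕ) - i ≤ m := by omega
  have hp : 0 < Real.pi / 2 ^ ((j : ℕ) - i) := by positivity
  by_cases h1 : i < j <;> by_cases h2 : (j : ℕ) - i ≤ k <;>
    by_cases h3 : b j ∧ b i <;> simp only [h1, h2, h3, hm, not_lt.2, not_le.1, and_self, and_true,
      and_false, if_true, if_false, sub_self, abs_zero, zero_sub, abs_neg, mul_zero,
      le_refl, mul_one_div, abs_of_pos hp, hp.le, not_false_eq_true]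

/-- Precision of the approximate Fourier transform with cutoff `k`. -/
theorem aqftPrecision_of_le {m k : ℕ} {η : ℝ} (h : m * (Real.pi / 2 ^ k) ≤ η) :
    AqftPrecision m k η := by
  intro φ
  rw [← run_aqft_eq_qft (LinearIsometryEquiv.refl ℂ ℂ) le_rfl, aqft_eq, aqft_eq,
    Circuit.run_append, Circuit.run_append, ← (Circuit.isLinearMap_run _ _).map_sub,
    Circuit.stateNorm_run]
  refine (stateNorm_run_flatMap_sub_le _ _ _ _
    (fun j φ => stateNorm_run_fourierStage_sub_le _ m k j φ) φ).trans ?_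
  rw [List.length_reverse, List.length_finRange]
  exact mul_le_mul_of_nonneg_right h (norm_nonneg _)

end Precision

/-! ### Gate and query counts. -/

section Counting

namespace Circuit
variable {Q Q' : Type}

theorem gateCount_append (A B : Circuit Q) :
    Circuit.gateCount (A ++ B) = A.gateCount + B.gateCount := List.countP_append

theorem queryCount_append (A B : Circuit Q) :
    Circuit.queryCount (A ++ B) = A.queryCount + B.queryCount := List.countP_append

theorem gateCount_flatMap {ι : Type} (l : List ι) (f : ι → Circuit Q) :
    Circuit.gateCount (l.flatMap f) = (l.map fun a => (f a).gateCount).sum := by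
  rw [gateCount, List.countP_flatMap]; rfl

theorem queryCount_flatMap {ι : Type} (l : List ι) (f : ι → Circuit Q) :
    Circuit.queryCount (l.flatMap f) = (l.map fun a => (f a).queryCount).sum := by
  rw [queryCount, List.countP_flatMap]; rfl

theorem gateCount_map (f : Q ↪ Q') (A : Circuit Q) :
    Circuit.gateCount (A.map (Gate.map f)) = A.gateCount := by
  rw [gateCount, List.countP_map]
  congr 1
  funext g
  cases g <;> rfl

theorem queryCount_map (f : Q ↪ Q') (A : Circuit Q) :
    Circuit.queryCount (A.map (Gate.map f)) = A.queryCount := by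
  rw [queryCount, List.countP_map]
  congr 1
  funext g
  cases g <;> rfl

theorem gateCount_inv (A : Circuit Q) : A.inv.gateCount = A.gateCount := by
  rw [gateCount, inv, List.countP_reverse, List.countP_map]
  congr 1
  funext g
  cases g <;> rfl

theorem queryCount_inv (A : Circuit Q) : A.inv.queryCount = A.queryCount := by
  rw [queryCount, inv, List.countP_reverse, List.countP_map]
  congr 1
  funext g
  cases g <;> rfl

end Circuit

/-- One Hadamard gate, and at most one rotation for each distance `1, …, k`. -/
theorem gateCount_fourierStage_le (m k : ℕ) (j : Fin m) :
    (fourierStage m k j).gateCount ≤ k + 1 := by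
  have h : (fourierStage m k j).gateCount =
      (phaseLadder m k j (List.finRange m)).gateCount + 1 := by
    simp [fourierStage, Circuit.gateCount, Gate.isQuery]
  rw [h, phaseLadder, Circuit.gateCount_flatMap, ← Fin.sum_univ_def]
  have h2 : ∀ i : Fin m, Circuit.gateCount (if h : i < j ∧ (j : ℕ) - i ≤ k then
      [Gate.two j i h.1.ne' (phaseGate (Real.pi / 2 ^ ((j : ℕ) - i)))] else []) =
      if i < j ∧ (j : ℕ) - i ≤ k then 1 else 0 := by
    intro i
    split_ifs <;> rfl
  simp only [h2]
  rw [← Finset.card_filter]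
  refine Nat.succ_le_succ ?_
  have : (Finset.univ.filter fun i : Fin m => i < j ∧ (j : ℕ) - i ≤ k).card ≤
      (Finset.Icc 1 k).card := by
    refine Finset.card_le_card_of_injOn (fun i => (j : ℕ) - i) ?_ ?_
    · intro i hi
      simp only [Finset.coe_filter, Finset.mem_univ, true_and, Set.mem_ofPred_eq, Fin.lt_def] at hi
      simp only [Finset.coe_Icc, Set.mem_Icc]
      omega
    · intro i hi i' hi' h
      simp only [Finset.coe_filter, Finset.mem_univ, true_and, Set.mem_ofPred_eq, Fin.lt_def] at hi hi'
      simp only at h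
      omega
  simpa using this

theorem gateCount_aqft_le (m k : ℕ) : (aqft m k).gateCount ≤ m * (k + 2) := by
  rw [aqft_eq, Circuit.gateCount_append, Circuit.gateCount_flatMap, reversalSwaps,
    Circuit.gateCount_flatMap, List.map_reverse, List.sum_reverse, ← Fin.sum_univ_def,
    ← Fin.sum_univ_def]
  have h1 : ∑ j : Fin m, (fourierStage m k j).gateCount ≤ ∑ j : Fin m, (k + 1) :=
    Finset.sum_le_sum fun j _ => gateCount_fourierStage_le m k j
  have h2 : ∑ i : Fin m, Circuit.gateCount (if h : i < i.rev then
      [Gate.two i i.rev h.ne swapGate] else []) ≤ ∑ i : Fin m, 1 :=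
    Finset.sum_le_sum fun i _ => by split_ifs <;> simp [Circuit.gateCount, Gate.isQuery]
  simp only [Finset.sum_const, Finset.card_univ, Fintype.card_fin, smul_eq_mul] at h1 h2
  linarith

theorem queryCount_aqft (m k : ℕ) : (aqft m k).queryCount = 0 := by
  rw [Circuit.queryCount, List.countP_eq_zero, aqft]
  intro g hg
  simp only [List.mem_append, List.mem_flatMap, List.mem_cons] at hg
  rcases hg with ⟨j, -, rfl | ⟨i, -, hg⟩⟩ | ⟨i, -, hg⟩
  · simp [Gate.isQuery]
  · split_ifs at hg <;> simp at hg
    subst hg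
    simp [Gate.isQuery]
  · split_ifs at hg <;> simp at hg
    subst hg
    simp [Gate.isQuery]

theorem gateCount_parallelAqft (q m k e : ℕ) :
    (parallelAqft q m k e).gateCount = q * (aqft m k).gateCount := by
  rw [parallelAqft, Circuit.gateCount_flatMap]
  simp [Circuit.gateCount_map]

theorem queryCount_parallelAqft (q m k e : ℕ) : (parallelAqft q m k e).queryCount = 0 := by
  rw [parallelAqft, Circuit.queryCount_flatMap]
  simp [Circuit.queryCount_map, queryCount_aqft]

theorem gateCount_controlledPowers (q m e : ℕ) : (controlledPowers q m e).gateCount = 0 := by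
  rw [Circuit.gateCount, List.countP_eq_zero, controlledPowers]
  intro g hg
  simp only [List.mem_flatMap, List.mem_replicate] at hg
  obtain ⟨r, -, j, -, -, rfl⟩ := hg
  simp [Gate.isQuery]

theorem queryCount_controlledPowers_le (q m e : ℕ) :
    (controlledPowers q m e).queryCount ≤ q * 2 ^ m := by
  rw [controlledPowers, Circuit.queryCount_flatMap]
  have h : ∀ r : Fin q, Circuit.queryCount ((List.finRange m).flatMap fun j : Fin m =>
      List.replicate (2 ^ (j : ℕ)) (Gate.query (peaRegister (e := e) r j))) ≤ 2 ^ m := by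
    intro r
    rw [Circuit.queryCount_flatMap, ← Fin.sum_univ_def]
    have : ∀ j : Fin m, Circuit.queryCount
        (List.replicate (2 ^ (j : ℕ)) (Gate.query (peaRegister (q := q) (e := e) r j))) = 2 ^ (j : ℕ) := by
      intro j
      simp [Circuit.queryCount, List.countP_replicate, Gate.isQuery]
    simp only [this]
    rw [Fin.sum_univ_eq_sum_range (fun i => 2 ^ i)]
    exact (Nat.geomSum_lt le_rfl fun i hi => Finset.mem_range.1 hi).le
  rw [← Fin.sum_univ_def]
  refine (Finset.sum_le_sum fun r _ => h r).trans ?_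
  simp

theorem gateCount_peaReflection {q m e : ℕ} (k : ℕ) (R : Circuit (PeaQubits q m e)) :
    (peaReflection k R).gateCount = 4 * (q * (aqft m k).gateCount) + R.gateCount := by
  simp only [peaReflection, peaCircuit, Circuit.gateCount_append, Circuit.gateCount_inv,
    gateCount_parallelAqft, gateCount_controlledPowers]
  ring

theorem queryCount_peaReflection_le {q m e : ℕ} (k : ℕ) {R : Circuit (PeaQubits q m e)}
    (hR : R.queryCount = 0) : (peaReflection k R).queryCount ≤ 2 * (q * 2 ^ m) := by
  have := queryCount_controlledPowers_le q m e
  simp only [peaReflection, peaCircuit, Circuit.queryCount_append, Circuit.queryCount_inv,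
    queryCount_parallelAqft, hR]
  omega

end Counting

/-! ### An exact reflection about `|0⟩` with linearly many gates. -/

section Reflection

/-- The NOT gate. -/
noncomputable def notGate : Matrix.unitaryGroup Bool ℂ :=
  ⟨Matrix.of fun x y => if x = !y then 1 else 0, by
    rw [Matrix.mem_unitaryGroup_iff]
    ext x y
    cases x <;> cases y <;> simp [Matrix.mul_apply, Matrix.star_apply]⟩

/-- The gate `diag(-1, 1)`. -/
noncomputable def signGate : Matrix.unitaryGroup Bool ℂ :=
  ⟨Matrix.of fun x y => if x = y then if x then 1 else -1 else 0, by
    rw [Matrix.mem_unitaryGroup_iff]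
    ext x y
    cases x <;> cases y <;> simp [Matrix.mul_apply, Matrix.star_apply]⟩

/-- The controlled NOT gate. -/
noncomputable def cnotGate : Matrix.unitaryGroup (Bool × Bool) ℂ :=
  ⟨Matrix.of fun x y => if x.1 = y.1 ∧ x.2 = xor y.1 y.2 then 1 else 0, by
    rw [Matrix.mem_unitaryGroup_iff]
    ext x y
    rcases x with ⟨x, x'⟩
    rcases y with ⟨y, y'⟩
    cases x <;> cases x' <;> cases y <;> cases y' <;>
      simp [Matrix.mul_apply, Matrix.star_apply, Fintype.sum_prod_type]⟩

variable {Q : Type} [DecidableEq Q] {E : Type*} [NormedAddCommGroup E] [InnerProductSpace ℂ E]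
  (U : E ≃ₗᵢ[ℂ] E)

theorem apply_notGate (i : Q) (ψ : Bits Q → E) (b : Bits Q) :
    (Gate.one i notGate).apply U ψ b = ψ (Function.update b i (!b i)) := by
  simp only [Gate.apply, notGate, Matrix.of_apply]
  cases b i <;> simp

theorem apply_signGate (i : Q) (ψ : Bits Q → E) (b : Bits Q) :
    (Gate.one i signGate).apply U ψ b = if b i then ψ b else -ψ b := by
  simp only [Gate.apply, signGate, Matrix.of_apply, ite_smul, zero_smul, Finset.sum_ite_eq,
    Finset.mem_univ, if_true, Function.update_eq_self, one_smul, neg_smul]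

theorem apply_cnotGate {i j : Q} (hij : i ≠ j) (ψ : Bits Q → E) (b : Bits Q) :
    (Gate.two i j hij cnotGate).apply U ψ b = ψ (Function.update b j (xor (b i) (b j))) := by
  have hi : Function.update b i (b i) = b := Function.update_eq_self i b
  simp only [Gate.apply, cnotGate, Matrix.of_apply]
  cases h : b i <;> cases h' : b j <;> rw [h] at hi <;> simp [hi]

/-- Flips `c` if `a` is set and `b` is not. -/
noncomputable def andNotCircuit {a b c : Q} (hab : a ≠ b) (hac : a ≠ c) (hbc : b ≠ c) : Circuit Q :=
  [Gate.one c hadamardGate,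
    Gate.two a c hac (phaseGate (Real.pi / 2)),
    Gate.two b c hbc (phaseGate (-(Real.pi / 2))),
    Gate.two a b hab cnotGate,
    Gate.two b c hbc (phaseGate (Real.pi / 2)),
    Gate.two a b hab cnotGate,
    Gate.one c hadamardGate]

/-- Reading bits as integers, `a - b + (a xor b) = 2 (a ∧ ¬b)`. The three controlled quarter turns
therefore give the sign `-1` exactly when `c` and `a ∧ ¬b` hold, and conjugation by Hadamard gates
on `c` turns this sign into a flip. -/
theorem run_andNotCircuit {a b c : Q} (hab : a ≠ b) (hac : a ≠ c) (hbc : b ≠ c)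
    (ψ : Bits Q → E) (β : Bits Q) :
    (andNotCircuit hab hac hbc).run U ψ β =
      ψ (Function.update β c (xor (β c) (β a && !β b))) := by
  have hphase : ∀ (φ : Bits Q → E) (β : Bits Q),
      Circuit.run U [Gate.two a c hac (phaseGate (Real.pi / 2)),
        Gate.two b c hbc (phaseGate (-(Real.pi / 2))),
        Gate.two a b hab cnotGate,
        Gate.two b c hbc (phaseGate (Real.pi / 2)),
        Gate.two a b hab cnotGate] φ β =
      if β c && (β a && !β b) then -φ β else φ β := by
    intro φ β
    have hI : Complex.exp (-(Real.pi / 2 * Complex.I)) = -Complex.I := by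
      rw [Complex.exp_neg, Complex.exp_pi_div_two_mul_I, Complex.inv_I]
    have hβ : ∀ x, β b = x → Function.update β b x = β := fun x h => by
      rw [← h, Function.update_eq_self]
    simp only [Circuit.run_cons, Circuit.run_nil, apply_cnotGate, apply_phaseGate,
      Function.update_self, Function.update_idem, Function.update_of_ne hab,
      Function.update_of_ne hbc.symm]
    cases ha : β a <;> cases hb : β b <;> cases hc : β c <;>
      simp [hβ _ hb, hI, smul_smul]
  have hsplit : andNotCircuit hab hac hbc = Gate.one c hadamardGate ::
      ([Gate.two a c hac (phaseGate (Real.pi / 2)),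
        Gate.two b c hbc (phaseGate (-(Real.pi / 2))),
        Gate.two a b hab cnotGate,
        Gate.two b c hbc (phaseGate (Real.pi / 2)),
        Gate.two a b hab cnotGate] ++ [Gate.one c hadamardGate]) := rfl
  have hs : (Real.sqrt 2 : ℂ)⁻¹ * (Real.sqrt 2 : ℂ)⁻¹ = 1 / 2 := by
    rw [← mul_inv, ← Complex.ofReal_mul, Real.mul_self_sqrt zero_le_two]
    norm_num
  rw [hsplit, Circuit.run_cons, Circuit.run_append, Circuit.run_cons, Circuit.run_nil]
  set φ := (Gate.one c hadamardGate).apply U ψ with hφ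
  simp only [Gate.apply, hphase, Function.update_self, Function.update_of_ne hac,
    Function.update_of_ne hbc]
  have hval : ∀ x, φ (Function.update β c x) = ∑ y : Bool, hadamardGate.1 x y •
      ψ (Function.update β c y) := by
    intro x
    simp [hφ, Gate.apply]
  simp only [hval]
  cases hf : (β a && !β b) <;> cases hc : β c <;>
    simp [hadamardGate, smul_smul, hs, neg_div] <;> module

variable {ι : Type} [DecidableEq ι]

/-- One step of the chain that accumulates in the workspace whether all bits seen are `0`. -/
noncomputable def chainStep {n : ℕ} (e : Fin n → ι) (t : Fin n) : Circuit (ι ⊕ Fin (n + 1)) :=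
  andNotCircuit (a := Sum.inr t.castSucc) (b := Sum.inl (e t)) (c := Sum.inr t.succ)
    (by simp) (by simp [Fin.castSucc_lt_succ.ne]) (by simp)

/-- The amplitude at `b` comes from the preimage of `b`, found by undoing the steps from last to
first. Because `l` is increasing, undoing step `s` reads workspace bit `s` before that bit is itself
undone, so only entries of `b` occur. -/
theorem run_chainSteps {n : ℕ} (e : Fin n → ι) (l : List (Fin n)) (hl : l.Pairwise (· < ·))
    (ψ : Bits (ι ⊕ Fin (n + 1)) → E) (b : Bits (ι ⊕ Fin (n + 1))) :
    Circuit.run U (l.flatMap (chainStep e)) ψ b =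
      ψ (Sum.elim (fun i => b (Sum.inl i)) (Fin.cases (b (Sum.inr 0)) fun s =>
        if s ∈ l then xor (b (Sum.inr s.succ)) (b (Sum.inr s.castSucc) && !b (Sum.inl (e s)))
        else b (Sum.inr s.succ))) := by
  induction l generalizing ψ with
  | nil =>
    rw [List.flatMap_nil, Circuit.run_nil]
    congr 1
    funext x
    rcases x with x | x
    · rfl
    · refine Fin.cases ?_ (fun s => ?_) x <;> simp
  | cons a l ih =>
    have hlt := (List.pairwise_cons.1 hl).1
    rw [List.flatMap_cons, Circuit.run_append, ih (List.pairwise_cons.1 hl).2, chainStep,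
      run_andNotCircuit]
    congr 1
    have ha : a ∉ l := fun h => lt_irrefl _ (hlt a h)
    -- Steps after `a` alter only workspace bits above `a.castSucc`, so the control of step `a`
    -- still has its value from `b`.
    have hca : ∀ F : Fin n → Bool, (∀ s, s < a → F s = b (Sum.inr s.succ)) →
        (Fin.cases (b (Sum.inr 0)) F a.castSucc : Bool) = b (Sum.inr a.castSucc) := by
      intro F hF
      rcases Nat.eq_zero_or_pos a with h0 | h0
      · have : a.castSucc = 0 := Fin.ext h0
        rw [this, Fin.cases_zero]
      · have : a.castSucc = Fin.succ (⟨a - 1, by omega⟩ : Fin n) :=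
          Fin.ext (by simp; omega)
        rw [this, Fin.cases_succ]
        exact hF _ (Fin.lt_def.2 (by simp; omega))
    funext x
    rcases x with x | x
    · simp
    · refine Fin.cases ?_ (fun s => ?_) x
      · simp [(Fin.succ_ne_zero _).symm]
      · by_cases hs : s = a
        · subst hs
          simp only [Function.update_self, Sum.elim_inr, Sum.elim_inl, Fin.cases_succ, ha, if_false,
            List.mem_cons, true_or, if_true]
          rw [hca]
          intro s' hs'
          rw [if_neg fun h => (hlt s' h).not_gt hs']
        · simp [hs]

/-- Computes in the last workspace qubit whether all bits are `0`. -/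
noncomputable def zeroTestCircuit {n : ℕ} (e : Fin n → ι) : Circuit (ι ⊕ Fin (n + 1)) :=
  Gate.one (Sum.inr 0) notGate :: (List.finRange n).flatMap (chainStep e)

/-- The reflection `2|0⟩⟨0| - 1`: compute whether all bits are `0`, flip the sign, uncompute. -/
noncomputable def zeroReflectionCircuit {n : ℕ} (e : Fin n → ι) : Circuit (ι ⊕ Fin (n + 1)) :=
  zeroTestCircuit e ++ [Gate.one (Sum.inr (Fin.last n)) signGate] ++ (zeroTestCircuit e).inv

/-- The circuit permutes basis states, and `b'` is the preimage of `b`. If the workspace of `b'` is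
clean, workspace bit `t` of `b` is the conjunction of the negations of the first `t` register bits;
surjectivity of `e` makes the last one test all of them. -/
theorem exists_run_zeroTestCircuit {n : ℕ} {e : Fin n → ι} (he : Function.Surjective e)
    (b : Bits (ι ⊕ Fin (n + 1))) : ∃ b' : Bits (ι ⊕ Fin (n + 1)),
      (∀ ψ : Bits (ι ⊕ Fin (n + 1)) → E, (zeroTestCircuit e).run U ψ b = ψ b') ∧
      ((∀ t, b' (Sum.inr t) = false) →
        (b (Sum.inr (Fin.last n)) = true ↔ ∀ i, b' (Sum.inl i) = false)) := by
  refine ⟨Sum.elim (fun i => b (Sum.inl i)) (Fin.cases (!b (Sum.inr 0)) fun s =>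
    xor (b (Sum.inr s.succ)) (b (Sum.inr s.castSucc) && !b (Sum.inl (e s)))), fun ψ => ?_,
    fun h => ?_⟩
  · rw [zeroTestCircuit, Circuit.run_cons, run_chainSteps U e _ (List.pairwise_lt_finRange n),
      apply_notGate]
    congr 1
    funext x
    rcases x with x | x
    · simp
    · refine Fin.cases ?_ (fun s => ?_) x
      · simp
      · simp [Fin.succ_ne_zero, List.mem_finRange]
  · have h0 := h 0
    have hs : ∀ s : Fin n, b (Sum.inr s.succ) = (b (Sum.inr s.castSucc) && !b (Sum.inl (e s))) := by
      intro s
      have := h s.succ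
      simpa using this
    have hall : ∀ t : Fin (n + 1), b (Sum.inr t) = true ↔
        ∀ s : Fin n, s.castSucc < t → b (Sum.inl (e s)) = false := by
      intro t
      induction t using Fin.induction with
      | zero => simpa using h0
      | succ t ih =>
        rw [hs, Bool.and_eq_true, ih]
        simp only [Fin.castSucc_lt_succ_iff, Fin.castSucc_lt_castSucc_iff, Bool.not_eq_true']
        constructor
        · rintro ⟨h1, h2⟩ s hst
          rcases hst.lt_or_eq with h3 | rfl
          · exact h1 s h3
          · exact h2
        · exact fun h => ⟨fun s hst => h s hst.le, h t le_rfl⟩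
    rw [hall]
    simp only [Fin.castSucc_lt_last, forall_const, Sum.elim_inl]
    exact (he.forall (p := fun i => b (Sum.inl i) = false)).symm

/-- Stated for an arbitrary system so that it serves both `ImplementsZeroReflection`, where the
system is `ℂ`, and the joint states produced by phase estimation. Before uncomputation both sides
carry the same sign, since only preimages with clean workspace contribute. -/
theorem run_zeroReflectionCircuit {n : ℕ} {e : Fin n → ι} (he : Function.Surjective e)
    (ψ : Bits (ι ⊕ Fin (n + 1)) → E) (hψ : ∀ b, ¬ (∀ t, b (Sum.inr t) = false) → ψ b = 0)
    [Fintype ι] :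
    (zeroReflectionCircuit e).run U ψ =
      fun b => if ∀ i, b (Sum.inl i) = false then ψ b else -ψ b := by
  rw [zeroReflectionCircuit, Circuit.run_append, Circuit.run_append]
  conv_rhs => rw [← (zeroTestCircuit e).inv_run_run U
    (fun b => if ∀ i, b (Sum.inl i) = false then ψ b else -ψ b)]
  congr 1
  funext b
  obtain ⟨b', h1, h2⟩ := exists_run_zeroTestCircuit U he b
  rw [Circuit.run_cons, Circuit.run_nil, apply_signGate, h1, h1]
  by_cases h : ∀ t, b' (Sum.inr t) = false
  · simp only [h2 h]
  · simp [hψ b' h]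

theorem queryCount_zeroTestCircuit {n : ℕ} (e : Fin n → ι) :
    (zeroTestCircuit e).queryCount = 0 := by
  have : ∀ t, (chainStep e t).queryCount = 0 := fun t => rfl
  rw [zeroTestCircuit, ← List.singleton_append, Circuit.queryCount_append,
    Circuit.queryCount_flatMap]
  simp only [this]
  simp [Circuit.queryCount, Gate.isQuery]

theorem gateCount_zeroTestCircuit {n : ℕ} (e : Fin n → ι) :
    (zeroTestCircuit e).gateCount = 1 + 7 * n := by
  have : ∀ t, (chainStep e t).gateCount = 7 := fun t => rfl
  rw [zeroTestCircuit, ← List.singleton_append, Circuit.gateCount_append,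
    Circuit.gateCount_flatMap]
  simp only [this]
  simp [Circuit.gateCount, Gate.isQuery, mul_comm]

theorem queryCount_zeroReflectionCircuit {n : ℕ} (e : Fin n → ι) :
    (zeroReflectionCircuit e).queryCount = 0 := by
  rw [zeroReflectionCircuit, Circuit.queryCount_append, Circuit.queryCount_append,
    Circuit.queryCount_inv, queryCount_zeroTestCircuit]
  rfl

theorem gateCount_zeroReflectionCircuit {n : ℕ} (e : Fin n → ι) :
    (zeroReflectionCircuit e).gateCount = 14 * n + 3 := by
  rw [zeroReflectionCircuit, Circuit.gateCount_append, Circuit.gateCount_append,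
    Circuit.gateCount_inv, gateCount_zeroTestCircuit]
  simp [Circuit.gateCount, Gate.isQuery]
  ring

theorem implementsZeroReflection_zeroReflectionCircuit {q m : ℕ}
    {e : Fin (q * m) → Fin q × Fin m} (he : Function.Surjective e) :
    ImplementsZeroReflection (e := q * m + 1) (zeroReflectionCircuit e) := by
  refine ⟨queryCount_zeroReflectionCircuit e, fun φ => ?_⟩
  rw [run_zeroReflectionCircuit _ he]
  · funext b
    simp only [withWorkspace, zeroReflection]
    split_ifs <;> simp
  · intro b hb
    rw [withWorkspace, if_neg hb]

end Reflection

/-! ### Averaged powers of a unitary with a spectral gap. -/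

section Spectral

variable {E : Type*} [NormedAddCommGroup E] [InnerProductSpace ℂ E]

/-- A unitary is normal, so the norm of a polynomial in it is controlled on the spectrum, which in
finite dimension consists of eigenvalues. -/
theorem norm_aeval_linearIsometryEquiv_le [FiniteDimensional ℂ E] (V : E ≃ₗᵢ[ℂ] E)
    (p : Polynomial ℂ) {c : ℝ} (hc : 0 ≤ c)
    (h : ∀ μ, Module.End.HasEigenvalue (V.toLinearEquiv.toLinearMap : Module.End ℂ E) μ →
      ‖p.eval μ‖ ≤ c) :
    ‖Polynomial.aeval (V.toContinuousLinearEquiv : E →L[ℂ] E) p‖ ≤ c := by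
  have := FiniteDimensional.complete ℂ E
  have hV : IsStarNormal (V.toContinuousLinearEquiv : E →L[ℂ] E) := by
    have hu := (Unitary.linearIsometryEquiv.symm V).2
    have he : ((Unitary.linearIsometryEquiv.symm V : unitary (E →L[ℂ] E)) : E →L[ℂ] E) =
      (V.toContinuousLinearEquiv : E →L[ℂ] E) := rfl
    rw [he, Unitary.mem_iff] at hu
    exact ⟨hu.1.trans hu.2.symm⟩
  rw [← cfc_polynomial p (V.toContinuousLinearEquiv : E →L[ℂ] E)]
  refine norm_cfc_le hc fun μ hμ => h μ ?_
  rw [Module.End.hasEigenvalue_iff_mem_spectrum]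
  have he : (V.toContinuousLinearEquiv : E →L[ℂ] E) =
    Module.End.toContinuousLinearMap E (V.toLinearEquiv.toLinearMap : Module.End ℂ E) := rfl
  rwa [he, AlgEquiv.spectrum_eq] at hμ

/-- The operator `⟨0|W|0⟩` of the phase estimation circuit: the average of the powers of `U` over
all contents of the registers. -/
noncomputable def powerAverage (ι : Type) [Fintype ι] [DecidableEq ι] (w : ι → ℕ) (U : E ≃ₗᵢ[ℂ] E)
    (ξ : E) : E :=
  (1 / 2 : ℂ) ^ Fintype.card ι • ∑ c : ι → Bool, (U ^ (∑ i, if c i then w i else 0)) ξ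

theorem linearIsometryEquiv_mul_apply (U V : E ≃ₗᵢ[ℂ] E) (ξ : E) : (U * V) ξ = U (V ξ) := rfl

theorem coe_linearIsometryEquiv_pow (U : E ≃ₗᵢ[ℂ] E) (n : ℕ) (ξ : E) :
    ((U.toContinuousLinearEquiv : E →L[ℂ] E) ^ n) ξ = (U ^ n) ξ := by
  induction n generalizing ξ with
  | zero => rfl
  | succ n ih =>
    rw [pow_succ, pow_succ, mul_apply_eq_comp, linearIsometryEquiv_mul_apply, ih]
    rfl

variable {ι : Type} [Fintype ι] [DecidableEq ι]

theorem powerAverage_eq_aeval (w : ι → ℕ) (U : E ≃ₗᵢ[ℂ] E) (ξ : E) :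
    powerAverage ι w U ξ = Polynomial.aeval (U.toContinuousLinearEquiv : E →L[ℂ] E)
      (∏ i : ι, (Polynomial.C (1 / 2 : ℂ) * (1 + Polynomial.X ^ w i))) ξ := by
  have h : ∏ i : ι, (1 + Polynomial.X ^ w i : Polynomial ℂ) =
      ∑ c : ι → Bool, Polynomial.X ^ (∑ i, if c i then w i else 0) := by
    have h1 : ∀ i, (1 + Polynomial.X ^ w i : Polynomial ℂ) =
        ∑ t : Bool, Polynomial.X ^ (if t then w i else 0) := by
      intro i
      simp [add_comm]
    simp only [h1]
    rw [Fintype.prod_sum]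
    exact Finset.sum_congr rfl fun c _ => Finset.prod_pow_eq_pow_sum _ _ _
  rw [Finset.prod_mul_distrib, Finset.prod_const, h, map_mul, map_pow, Polynomial.aeval_C, map_sum,
    ← map_pow, Finset.card_univ, ← Algebra.smul_def, smul_apply,
    sum_apply, powerAverage]
  simp only [map_pow, Polynomial.aeval_X, coe_linearIsometryEquiv_pow]

theorem powerAverage_add (w : ι → ℕ) (U : E ≃ₗᵢ[ℂ] E) (ξ η : E) :
    powerAverage ι w U (ξ + η) = powerAverage ι w U ξ + powerAverage ι w U η := by
  simp only [powerAverage_eq_aeval, map_add]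

theorem linearIsometryEquiv_pow_apply_of_fixed {U : E ≃ₗᵢ[ℂ] E} {v : E} (hv : U v = v) (n : ℕ) :
    (U ^ n) v = v := by
  induction n with
  | zero => rfl
  | succ n ih => rw [pow_succ, linearIsometryEquiv_mul_apply, hv, ih]

theorem powerAverage_of_fixed (w : ι → ℕ) {U : E ≃ₗᵢ[ℂ] E} {v : E} (hv : U v = v) :
    powerAverage ι w U v = v := by
  simp only [powerAverage, linearIsometryEquiv_pow_apply_of_fixed hv, Finset.sum_const,
    Finset.card_univ, Fintype.card_fun, Fintype.card_bool]
  rw [← Nat.cast_smul_eq_nsmul ℂ, smul_smul]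
  push_cast
  rw [← mul_pow]
  norm_num

theorem sub_one_mul_prod_one_add_pow (μ : ℂ) (m : ℕ) :
    (μ - 1) * ∏ j ∈ Finset.range m, (1 + μ ^ 2 ^ j) = μ ^ 2 ^ m - 1 := by
  induction m with
  | zero => simp
  | succ m ih =>
    rw [Finset.prod_range_succ, ← mul_assoc, ih, pow_succ 2 m, pow_mul]
    ring

/-- Divide the telescoping identity by `|μ - 1| = 2 sin(θ/2)`, which is at least `2Δ/π` by Jordan's
inequality on either side of `π`; the numerator is at most `2`. -/
theorem norm_prod_half_one_add_pow_le {θ Δ : ℝ} (hΔ : 0 < Δ) (h1 : Δ ≤ θ)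
    (h2 : θ ≤ 2 * Real.pi - Δ) {m : ℕ} (hm : 2 * Real.pi / Δ ≤ 2 ^ m) :
    ‖∏ j : Fin m, (1 / 2 * (1 + Complex.exp (θ * Complex.I) ^ 2 ^ (j : ℕ)) : ℂ)‖ ≤ 1 / 2 := by
  set μ := Complex.exp (θ * Complex.I) with hμ
  have hμ1 : ‖μ‖ = 1 := Complex.norm_exp_ofReal_mul_I θ
  have hsin : Δ / Real.pi ≤ Real.sin (θ / 2) := by
    have hd : Δ / Real.pi = 2 / Real.pi * (Δ / 2) := by ring
    rcases le_total (θ / 2) (Real.pi / 2) with h | h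
    · refine le_trans ?_ (Real.mul_le_sin (by linarith) h)
      rw [hd]
      gcongr
    · rw [← Real.sin_pi_sub]
      refine le_trans ?_ (Real.mul_le_sin (by linarith) (by linarith))
      rw [hd]
      gcongr
      linarith
  have hsub : 2 * (Δ / Real.pi) ≤ ‖μ - 1‖ := by
    rw [hμ, mul_comm (θ : ℂ), Complex.norm_exp_I_mul_ofReal_sub_one, Real.norm_eq_abs]
    exact (mul_le_mul_of_nonneg_left hsin zero_le_two).trans (le_abs_self _)
  have hprod := congrArg norm (sub_one_mul_prod_one_add_pow μ m)
  rw [norm_mul] at hprod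
  have hle : ‖μ ^ 2 ^ m - 1‖ ≤ 2 := by
    refine (norm_sub_le _ _).trans ?_
    rw [norm_pow, hμ1, one_pow, norm_one]
    norm_num
  have hD : 0 < Δ / Real.pi := div_pos hΔ Real.pi_pos
  have hP : ‖∏ j ∈ Finset.range m, (1 + μ ^ 2 ^ j)‖ ≤ Real.pi / Δ := by
    have h3 : 2 * (Δ / Real.pi) * ‖∏ j ∈ Finset.range m, (1 + μ ^ 2 ^ j)‖ ≤ 2 :=
      (mul_le_mul_of_nonneg_right hsub (norm_nonneg _)).trans (hprod.trans_le hle)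
    rw [le_div_iff₀ hΔ]
    have h4 : 2 * (Δ / Real.pi) * ‖∏ j ∈ Finset.range m, (1 + μ ^ 2 ^ j)‖ =
      2 * (‖∏ j ∈ Finset.range m, (1 + μ ^ 2 ^ j)‖ * Δ) / Real.pi := by ring
    rw [h4, div_le_iff₀ Real.pi_pos] at h3
    linarith
  rw [Finset.prod_mul_distrib, Finset.prod_const, Finset.card_univ, Fintype.card_fin,
    Fin.prod_univ_eq_prod_range (fun j => 1 + μ ^ 2 ^ j), norm_mul, norm_pow]
  have h5 : ‖(1 / 2 : ℂ)‖ = 1 / 2 := by norm_num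
  rw [h5, one_div_pow, one_div_mul_eq_div, div_le_div_iff₀ (by positivity) two_pos, one_mul]
  have h6 : 2 * Real.pi / Δ = Real.pi / Δ * 2 := by ring
  linarith [hm, hP, h6]

theorem exists_arg_of_norm_eq_one {μ : ℂ} (h : ‖μ‖ = 1) (h1 : μ ≠ 1) :
    ∃ θ : ℝ, 0 < θ ∧ θ < 2 * Real.pi ∧ Complex.exp (θ * Complex.I) = μ := by
  have he : Complex.exp (Complex.arg μ * Complex.I) = μ := by
    have := Complex.norm_mul_exp_arg_mul_I μ
    rwa [h, Complex.ofReal_one, one_mul] at this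
  have hpi := Real.pi_pos
  have h2 := Complex.arg_le_pi μ
  have h3 := Complex.neg_pi_lt_arg μ
  rcases lt_trichotomy (Complex.arg μ) 0 with h0 | h0 | h0
  · refine ⟨Complex.arg μ + 2 * Real.pi, by linarith, by linarith, ?_⟩
    push_cast
    rw [add_mul, Complex.exp_add, Complex.exp_two_pi_mul_I, he, mul_one]
  · exact absurd (by rw [← he, h0]; simp) h1
  · exact ⟨Complex.arg μ, h0, by linarith, he⟩

/-- On the orthogonal complement of the target state, the averaged powers of `U` are small. -/
theorem norm_powerAverage_le [FiniteDimensional ℂ E] {U : E ≃ₗᵢ[ℂ] E} {ψ₀ : E} {Δ : ℝ}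
    (hΔ : 0 < Δ) (hU : IsGappedTarget U ψ₀ Δ) (q : ℕ) {m : ℕ} (hm : 2 * Real.pi / Δ ≤ 2 ^ m)
    {v : E} (hv : v ∈ (Submodule.span ℂ {ψ₀})ᗮ) :
    ‖powerAverage (Fin q × Fin m) (fun i => 2 ^ (i.2 : ℕ)) U v‖ ≤ (1 / 2) ^ q * ‖v‖ := by
  obtain ⟨-, hfix, hgap⟩ := hU
  set K := (Submodule.span ℂ {ψ₀})ᗮ with hK
  have hψ : U ψ₀ = ψ₀ := (hfix ψ₀).2 (Submodule.mem_span_singleton_self ψ₀)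
  have hUK : ∀ x ∈ K, U x ∈ K := by
    intro x hx
    rw [hK, Submodule.mem_orthogonal_singleton_iff_inner_right] at hx ⊢
    rw [← hψ, U.inner_map_map, hx]
  -- Restricting `U` to the complement removes the eigenvalue `1`, on which the polynomial equals
  -- `1`.
  let V₀ : K →ₗᵢ[ℂ] K := ⟨U.toLinearEquiv.toLinearMap.restrict hUK, fun x => U.norm_map x⟩
  let V : K ≃ₗᵢ[ℂ] K := V₀.toLinearIsometryEquiv rfl
  have hV : ∀ x : K, ((V x : K) : E) = U x := fun x => rfl
  have hpow : ∀ (n : ℕ) (x : K), (((V ^ n) x : K) : E) = (U ^ n) x := by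
    intro n
    induction n with
    | zero => exact fun x => rfl
    | succ n ih =>
      intro x
      rw [pow_succ, pow_succ, linearIsometryEquiv_mul_apply, linearIsometryEquiv_mul_apply, ih, hV]
  have havg : powerAverage (Fin q × Fin m) (fun i => 2 ^ (i.2 : ℕ)) U v =
      (powerAverage (Fin q × Fin m) (fun i => 2 ^ (i.2 : ℕ)) V ⟨v, hv⟩ : K) := by
    simp [powerAverage, hpow]
  rw [havg, powerAverage_eq_aeval]
  refine le_trans (ContinuousLinearMap.le_of_opNorm_le _
    (norm_aeval_linearIsometryEquiv_le V _ (c := (1 / 2) ^ q) (by positivity) ?_) ⟨v, hv⟩) le_rfl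
  intro μ hμ
  obtain ⟨x, hx⟩ := hμ.exists_hasEigenvector
  have hx0 : (x : E) ≠ 0 := by simpa using hx.2
  have hxe : U x = μ • (x : E) := by
    have := congrArg Subtype.val hx.apply_eq_smul
    exact this
  have hμn : ‖μ‖ = 1 := by
    have h := U.norm_map x
    rw [hxe, norm_smul] at h
    exact mul_right_cancel₀ (norm_ne_zero_iff.2 hx0) (h.trans (one_mul _).symm)
  -- A fixed vector in `K` lies in the span of `ψ₀` and is orthogonal to it, hence zero.
  have hμ1 : μ ≠ 1 := by
    rintro rfl
    rw [one_smul, hfix] at hxe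
    exact hx0 (Submodule.inner_right_of_mem_orthogonal hxe x.2 |> inner_self_eq_zero.1)
  obtain ⟨θ, hθ0, hθ1, rfl⟩ := exists_arg_of_norm_eq_one hμn hμ1
  have hev : Module.End.HasEigenvalue (U.toLinearEquiv.toLinearMap : Module.End ℂ E)
      (Complex.exp (θ * Complex.I)) :=
    Module.End.hasEigenvalue_of_hasEigenvector
      (Module.End.hasEigenvector_iff.2 ⟨Module.End.mem_eigenspace_iff.2 hxe, hx0⟩)
  obtain ⟨h1, h2⟩ := hgap θ hθ0 hθ1 hev
  rw [Polynomial.eval_prod, Fintype.prod_prod_type]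
  simp only [Polynomial.eval_mul, Polynomial.eval_C, Polynomial.eval_add, Polynomial.eval_one,
    Polynomial.eval_pow, Polynomial.eval_X, Finset.prod_const, Finset.card_univ, Fintype.card_fin]
  rw [norm_pow]
  exact pow_le_pow_left₀ (norm_nonneg _) (norm_prod_half_one_add_pow_le hΔ h1 h2 hm) q

end Spectral

/-! ### The phase estimation circuit and the reflection built from it. -/

section PhaseEstimation

variable {E : Type*} [NormedAddCommGroup E] [InnerProductSpace ℂ E] (U : E ≃ₗᵢ[ℂ] E)
  {q m e : ℕ}

/-- The state `∑ b, |b⟩ ⊗ v` in the registers of `D`, all other qubits being in `|0⟩`. -/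
noncomputable def spreadState (m e : ℕ) (D : Finset (Fin q)) (v : E) :
    Bits (PeaQubits q m e) → E := fun b =>
  if (∀ r, r ∉ D → ∀ j, b (Sum.inl (r, j)) = false) ∧ ∀ t, b (Sum.inr t) = false then v else 0

theorem run_aqft_register (k : ℕ) (D : Finset (Fin q)) {r : Fin q} (hr : r ∉ D) (v : E) :
    Circuit.run U ((aqft m k).map (Gate.map (peaRegister (e := e) r))) (spreadState m e D v) =
      spreadState m e (insert r D) ((1 / (Real.sqrt 2 : ℂ)) ^ m • v) := by
  funext b
  conv_lhs => rw [← extend_comp_self (peaRegister r) b]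
  rw [Circuit.run_map]
  have h : (fun c => spreadState m e D v (Function.extend (peaRegister r) c b)) =
      zeroKet (Fin m) (spreadState m e (insert r D) v b) := by
    funext c
    have h1 : ∀ j, Function.extend (peaRegister (e := e) r) c b (Sum.inl (r, j)) = c j :=
      fun j => (peaRegister r).injective.extend_apply c b j
    have h2 : ∀ r', r' ≠ r → ∀ j : Fin m,
        Function.extend (peaRegister (e := e) r) c b (Sum.inl (r', j)) = b (Sum.inl (r', j)) := by
      intro r' hr' j
      refine Function.extend_apply' _ _ _ ?_
      rintro ⟨a, ha⟩
      exact hr' (Prod.mk.inj (Sum.inl.inj ha)).1.symm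
    have h3 : ∀ t, Function.extend (peaRegister (m := m) (e := e) r) c b (Sum.inr t) =
        b (Sum.inr t) := by
      intro t
      refine Function.extend_apply' _ _ _ ?_
      rintro ⟨a, ha⟩
      simp [peaRegister] at ha
    simp only [spreadState, zeroKet, h3, ← ite_and]
    congr 1
    rw [eq_iff_iff]
    constructor
    · rintro ⟨ha, hb⟩
      refine ⟨fun j => by rw [← h1]; exact ha r hr j, fun r' hr' j => ?_, hb⟩
      rw [Finset.mem_insert, not_or] at hr'
      rw [← h2 r' hr'.1]
      exact ha r' hr'.2 j
    · rintro ⟨hc, ha, hb⟩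
      refine ⟨fun r' hr' j => ?_, hb⟩
      by_cases hrr : r' = r
      · subst hrr
        rw [h1, hc]
      · rw [h2 r' hrr]
        exact ha r' (by simp [hrr, hr']) j
  rw [h, run_aqft_zeroKet]
  simp only [spreadState]
  split_ifs <;> simp

/-- Exact for every cutoff `k`, which is why the Fourier precision plays no role in the correctness
of the reflection. -/
theorem run_parallelAqft_zeroKet (k : ℕ) (ξ : E) :
    (parallelAqft q m k e).run U (zeroKet (PeaQubits q m e) ξ) =
      spreadState m e Finset.univ ((1 / (Real.sqrt 2 : ℂ)) ^ (q * m) • ξ) := by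
  have key : ∀ (l : List (Fin q)) (D : Finset (Fin q)) (v : E), l.Nodup → (∀ r ∈ l, r ∉ D) →
      Circuit.run U (l.flatMap fun r => (aqft m k).map (Gate.map (peaRegister (e := e) r)))
        (spreadState m e D v) =
      spreadState m e (D ∪ l.toFinset) ((1 / (Real.sqrt 2 : ℂ)) ^ (l.length * m) • v) := by
    intro l
    induction l with
    | nil => intro D v _ _; simp
    | cons r l ih =>
      intro D v hl hD
      rw [List.nodup_cons] at hl
      rw [List.flatMap_cons, Circuit.run_append,
        run_aqft_register U k D (hD r List.mem_cons_self) v, ih _ _ hl.2]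
      · rw [smul_smul, ← pow_add, List.length_cons, List.toFinset_cons, Finset.insert_union,
          Finset.union_insert, add_mul, one_mul]
      · intro r' hr'
        rw [Finset.mem_insert, not_or]
        exact ⟨fun h => hl.1 (h ▸ hr'), hD r' (List.mem_cons_of_mem _ hr')⟩
  have h0 : zeroKet (PeaQubits q m e) ξ = spreadState m e ∅ ξ := by
    funext b
    simp only [zeroKet, spreadState, Sum.forall, Prod.forall, Finset.notMem_empty,
      not_false_eq_true, true_imp_iff]
  rw [h0, parallelAqft, key _ _ _ (List.nodup_finRange q) (by simp), List.length_finRange,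
    Finset.empty_union]
  congr 1
  ext r
  simp

/-- The exponent of `U` for the register contents `c`. -/
def registersVal (c : Fin q × Fin m → Bool) : ℕ := ∑ i, if c i then 2 ^ (i.2 : ℕ) else 0

theorem run_controlledPowers (ψ : Bits (PeaQubits q m e) → E) (b : Bits (PeaQubits q m e)) :
    (controlledPowers q m e).run U ψ b =
      (U ^ registersVal fun i => b (Sum.inl i)) (ψ b) := by
  have hrep : ∀ (c : PeaQubits q m e) (n : ℕ) (ψ : Bits (PeaQubits q m e) → E),
      Circuit.run U (List.replicate n (Gate.query c)) ψ b =
        (U ^ (if b c then n else 0)) (ψ b) := by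
    intro c n
    induction n with
    | zero => intro ψ; simp
    | succ n ih =>
      intro ψ
      rw [List.replicate_succ, Circuit.run_cons, ih]
      by_cases h : b c
      · simp only [h, if_true, Gate.apply, pow_succ, linearIsometryEquiv_mul_apply]
      · simp [h, Gate.apply]
  have hflat : ∀ {κ : Type} (l : List κ) (f : κ → Circuit (PeaQubits q m e)) (n : κ → ℕ),
      (∀ a ψ, (f a).run U ψ b = (U ^ n a) (ψ b)) → ∀ ψ,
      Circuit.run U (l.flatMap f) ψ b = (U ^ (l.map n).sum) (ψ b) := by
    intro κ l f n hf
    induction l with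
    | nil => intro ψ; simp
    | cons a l ih =>
      intro ψ
      rw [List.flatMap_cons, Circuit.run_append, ih, hf, List.map_cons, List.sum_cons, add_comm,
        pow_add, linearIsometryEquiv_mul_apply]
  rw [controlledPowers, hflat _ _ _ fun r ψ => hflat _ _ _ (fun j ψ => hrep _ _ ψ) ψ]
  rw [registersVal, Fintype.sum_prod_type, Fin.sum_univ_def]
  simp only [Fin.sum_univ_def]
  rfl

/-- Operations on the registers leave the workspace in the state `|0⟩`. -/
theorem run_eq_zero_of_workspace (A : Circuit (PeaQubits q m e))
    (hA : ∀ g ∈ A, ∃ (r : Fin q) (g₀ : Gate (Fin m)), g = g₀.map (peaRegister r))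
    (ψ : Bits (PeaQubits q m e) → E) (hψ : ∀ b, ¬ (∀ t, b (Sum.inr t) = false) → ψ b = 0) :
    ∀ b, ¬ (∀ t, b (Sum.inr t) = false) → A.run U ψ b = 0 := by
  induction A generalizing ψ with
  | nil => exact hψ
  | cons g A ih =>
    refine ih (fun g' hg' => hA g' (List.mem_cons_of_mem _ hg')) _ fun b hb => ?_
    obtain ⟨r, g₀, rfl⟩ := hA g List.mem_cons_self
    change (Gate.map (peaRegister r) g₀).apply U ψ b = 0
    rw [← extend_comp_self (peaRegister r) b, Gate.apply_map]
    have h : (fun c => ψ (Function.extend (peaRegister r) c b)) = 0 := by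
      funext c
      refine hψ _ fun h => hb fun t => ?_
      rw [← h t]
      refine (Function.extend_apply' _ _ _ ?_).symm
      rintro ⟨a, ha⟩
      simp [peaRegister] at ha
    rw [h, (g₀.isLinearMap_apply U).map_zero]
    rfl

theorem exists_map_of_mem_parallelAqft {k : ℕ} {g : Gate (PeaQubits q m e)}
    (hg : g ∈ parallelAqft q m k e) :
    ∃ (r : Fin q) (g₀ : Gate (Fin m)), g = g₀.map (peaRegister r) := by
  simp only [parallelAqft, List.mem_flatMap, List.mem_map] at hg
  obtain ⟨r, -, g₀, -, rfl⟩ := hg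
  exact ⟨r, g₀, rfl⟩

theorem exists_map_of_mem_peaCircuit {k : ℕ} {g : Gate (PeaQubits q m e)}
    (hg : g ∈ peaCircuit q m k e) :
    ∃ (r : Fin q) (g₀ : Gate (Fin m)), g = g₀.map (peaRegister r) := by
  simp only [peaCircuit, List.mem_append] at hg
  rcases hg with (hg | hg) | hg
  · exact exists_map_of_mem_parallelAqft hg
  · simp only [controlledPowers, List.mem_flatMap, List.mem_replicate] at hg
    obtain ⟨r, -, j, -, -, rfl⟩ := hg
    exact ⟨r, Gate.query j, rfl⟩
  · simp only [Circuit.inv, List.mem_reverse, List.mem_map] at hg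
    obtain ⟨g', hg', rfl⟩ := hg
    obtain ⟨r, g₀, rfl⟩ := exists_map_of_mem_parallelAqft hg'
    refine ⟨r, g₀.adjoint, ?_⟩
    cases g₀ <;> rfl

theorem run_peaCircuit_zeroKet (k : ℕ) (ξ : E) :
    (peaCircuit q m k e).run U (zeroKet _ ξ) = (parallelAqft q m k e).inv.run U
      fun b => if ∀ t, b (Sum.inr t) = false then
        (1 / (Real.sqrt 2 : ℂ)) ^ (q * m) • (U ^ registersVal fun i => b (Sum.inl i)) ξ else 0 := by
  rw [peaCircuit, Circuit.run_append, Circuit.run_append, run_parallelAqft_zeroKet]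
  congr 1
  funext b
  rw [run_controlledPowers, spreadState]
  by_cases h : ∀ t, b (Sum.inr t) = false <;> simp [h]

/-- Phase estimation does not change a state fixed by `U`. -/
theorem run_peaCircuit_zeroKet_of_fixed (k : ℕ) {v : E} (hv : U v = v) :
    (peaCircuit q m k e).run U (zeroKet _ v) = zeroKet _ v := by
  rw [run_peaCircuit_zeroKet]
  conv_rhs => rw [← (parallelAqft q m k e).inv_run_run U (zeroKet _ v)]
  rw [run_parallelAqft_zeroKet]
  congr 1
  funext b
  simp only [linearIsometryEquiv_pow_apply_of_fixed hv, spreadState]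
  by_cases h : ∀ t, b (Sum.inr t) = false <;> simp [h]

theorem stateInner_zeroKet {Q : Type} [DecidableEq Q] [Fintype Q] (v : E) (φ : Bits Q → E) :
    stateInner (zeroKet Q v) φ = inner ℂ v (φ fun _ => false) := by
  rw [stateInner, Finset.sum_eq_single (fun _ => false)]
  · simp [zeroKet]
  · intro b _ hb
    rw [zeroKet, if_neg (fun h => hb (funext h)), inner_zero_left]
  · simp

/-- Pair with `|0⟩v` and move the inverse Fourier transforms to the other side. Both sides become
uniform superpositions, and the two normalizations multiply to `2^(-qm)`. -/
theorem run_peaCircuit_zeroKet_apply_zero (k : ℕ) (ξ : E) :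
    (peaCircuit q m k e).run U (zeroKet _ ξ) (fun _ => false) =
      powerAverage (Fin q × Fin m) (fun i => 2 ^ (i.2 : ℕ)) U ξ := by
  refine ext_inner_left ℂ fun v => ?_
  have hs : (1 / (Real.sqrt 2 : ℂ)) * (starRingEnd ℂ) (1 / (Real.sqrt 2 : ℂ)) = 1 / 2 := by
    rw [map_div₀, map_one, Complex.conj_ofReal, div_mul_div_comm, one_mul, ← Complex.ofReal_mul,
      Real.mul_self_sqrt zero_le_two]
    norm_num
  rw [← stateInner_zeroKet, run_peaCircuit_zeroKet, ← Circuit.stateInner_run,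
    run_parallelAqft_zeroKet, stateInner, powerAverage, inner_smul_right, inner_sum,
    ← (Equiv.sumArrowEquivProdArrow (Fin q × Fin m) (Fin e) Bool).symm.sum_comp,
    Fintype.sum_prod_type, Finset.mul_sum]
  refine Finset.sum_congr rfl fun c _ => ?_
  rw [Finset.sum_eq_single (fun _ => false)]
  · simp only [spreadState, Finset.mem_univ, not_true_eq_false, false_imp_iff, implies_true,
      true_and, Equiv.sumArrowEquivProdArrow_symm_apply_inr,
      Equiv.sumArrowEquivProdArrow_symm_apply_inl, if_true, inner_smul_left, inner_smul_right]
    rw [← mul_assoc, map_pow, ← mul_pow, hs, Fintype.card_prod, Fintype.card_fin, Fintype.card_fin]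
    rfl
  · intro b _ hb
    have : ¬ ∀ t, b t = false := fun h => hb (funext h)
    simp [spreadState, this]
  · simp

/-- Phase estimation leaves the workspace clean, so `hR` applies to its output; the projection onto
`|0⟩` then retains just the amplitude `powerAverage`. -/
theorem run_peaReflection_zeroKet (k : ℕ) {R : Circuit (PeaQubits q m e)}
    (hR : ∀ ψ : Bits (PeaQubits q m e) → E, (∀ b, ¬ (∀ t, b (Sum.inr t) = false) → ψ b = 0) →
      R.run U ψ = fun b => if ∀ i, b (Sum.inl i) = false then ψ b else -ψ b) (ξ : E) :
    (peaReflection k R).run U (zeroKet _ ξ) =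
      (2 : ℂ) • (peaCircuit q m k e).inv.run U
        (zeroKet _ (powerAverage (Fin q × Fin m) (fun i => 2 ^ (i.2 : ℕ)) U ξ)) -
      zeroKet _ ξ := by
  have hsupp := run_eq_zero_of_workspace U (peaCircuit q m k e)
    (fun g hg => exists_map_of_mem_peaCircuit hg) (zeroKet _ ξ) (by
      intro b hb
      rw [zeroKet, if_neg fun h => hb fun t => h (Sum.inr t)])
  rw [peaReflection, Circuit.run_append, Circuit.run_append, hR _ hsupp]
  conv_rhs => rw [← (peaCircuit q m k e).inv_run_run U (zeroKet _ ξ)]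
  rw [← (Circuit.isLinearMap_run U _).map_smul, ← (Circuit.isLinearMap_run U _).map_sub]
  congr 1
  funext b
  rw [Pi.sub_apply, Pi.smul_apply, ← run_peaCircuit_zeroKet_apply_zero U (e := e) k ξ, zeroKet]
  by_cases hb : ∀ i, b i = false
  · have hb' : b = fun _ => false := funext hb
    subst hb'
    simp [two_smul]
  · rw [if_neg hb, smul_zero, zero_sub]
    split_ifs with h
    · rw [hsupp b fun h' => hb (by rintro (i | t) <;> [exact h i; exact h' t]), neg_zero]
    · rfl

theorem stateNorm_zeroKet {Q : Type} [DecidableEq Q] [Fintype Q] (v : E) :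
    stateNorm (zeroKet Q v) = ‖v‖ := by
  have h : stateNorm (zeroKet Q v) ^ 2 = ‖v‖ ^ 2 := by
    rw [stateNorm_sq, Finset.sum_eq_single (fun _ => false)]
    · simp [zeroKet]
    · intro b _ hb
      rw [zeroKet, if_neg (fun h => hb (funext h)), norm_zero, zero_pow two_ne_zero]
    · simp
  exact (pow_left_inj₀ (norm_nonneg _) (norm_nonneg _) two_ne_zero).1 h

/-- The component along `ψ₀` is treated exactly, so the whole error is twice the norm of
`powerAverage` on the orthogonal component. -/
theorem peaReflection_correct [FiniteDimensional ℂ E] (k : ℕ) {R : Circuit (PeaQubits q m e)}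
    (hR : ∀ ψ : Bits (PeaQubits q m e) → E, (∀ b, ¬ (∀ t, b (Sum.inr t) = false) → ψ b = 0) →
      R.run U ψ = fun b => if ∀ i, b (Sum.inl i) = false then ψ b else -ψ b)
    {ψ₀ : E} {Δ : ℝ} (hΔ : 0 < Δ) (hm : 2 * Real.pi / Δ ≤ 2 ^ m) (hU : IsGappedTarget U ψ₀ Δ) :
    (peaReflection k R).run U (zeroKet (PeaQubits q m e) ψ₀) = zeroKet (PeaQubits q m e) ψ₀ ∧
    ∀ ξ : E, ‖ξ‖ = 1 →
      stateNorm ((peaReflection k R).run U (zeroKet (PeaQubits q m e) ξ) -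
        zeroKet (PeaQubits q m e) ((Submodule.span ℂ {ψ₀}).reflection ξ)) ≤ 2 * (1 / 2) ^ q := by
  have hinv : ∀ v, U v = v → (peaCircuit q m k e).inv.run U (zeroKet _ v) = zeroKet _ v := by
    intro v hv
    conv_lhs => rw [← run_peaCircuit_zeroKet_of_fixed U k hv]
    exact Circuit.inv_run_run U _ _
  have hψ : U ψ₀ = ψ₀ := (hU.2.1 ψ₀).2 (Submodule.mem_span_singleton_self ψ₀)
  refine ⟨?_, fun ξ hξ => ?_⟩
  · rw [run_peaReflection_zeroKet U k hR, powerAverage_of_fixed _ hψ, hinv _ hψ, two_smul,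
      add_sub_cancel_right]
  · set K := Submodule.span ℂ {ψ₀} with hK
    set p := K.starProjection ξ with hp
    have hpf : U p = p := (hU.2.1 p).2 (K.starProjection_apply_mem ξ)
    have hη : ξ - p ∈ Kᗮ := K.sub_starProjection_mem_orthogonal ξ
    have hadd : ∀ x y : E, zeroKet (PeaQubits q m e) (x + y) = zeroKet _ x + zeroKet _ y := by
      intro x y
      funext b
      simp only [zeroKet, Pi.add_apply]
      split_ifs <;> simp
    have havg : powerAverage (Fin q × Fin m) (fun i => 2 ^ (i.2 : ℕ)) U ξ =
        p + powerAverage (Fin q × Fin m) (fun i => 2 ^ (i.2 : ℕ)) U (ξ - p) := by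
      conv_lhs => rw [← add_sub_cancel p ξ]
      rw [powerAverage_add, powerAverage_of_fixed _ hpf]
    have hrefl : zeroKet (PeaQubits q m e) (K.reflection ξ) + zeroKet _ ξ =
        (2 : ℂ) • zeroKet _ p := by
      rw [← hadd, Submodule.reflection_apply, sub_add_cancel, two_smul, hadd, two_smul]
    have hdiff : (peaReflection k R).run U (zeroKet (PeaQubits q m e) ξ) -
        zeroKet (PeaQubits q m e) (K.reflection ξ) = (peaCircuit q m k e).inv.run U
          ((2 : ℂ) • zeroKet _ (powerAverage (Fin q × Fin m) (fun i => 2 ^ (i.2 : ℕ)) U (ξ - p))) := by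
      rw [run_peaReflection_zeroKet U k hR, sub_sub, add_comm (zeroKet _ ξ), hrefl, havg, hadd,
        (Circuit.isLinearMap_run U _).map_add, hinv _ hpf, smul_add, add_sub_cancel_left,
        (Circuit.isLinearMap_run U _).map_smul]
    rw [hdiff, Circuit.stateNorm_run]
    have h2 : ∀ φ : Bits (PeaQubits q m e) → E, stateNorm ((2 : ℂ) • φ) ≤ 2 * stateNorm φ := by
      intro φ
      refine stateNorm_le_of_forall_norm_le zero_le_two fun b => ?_
      rw [Pi.smul_apply, norm_smul, Complex.norm_ofNat]
    refine (h2 _).trans (mul_le_mul_of_nonneg_left ?_ zero_le_two)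
    rw [stateNorm_zeroKet]
    refine (norm_powerAverage_le hΔ hU q hm hη).trans ?_
    refine mul_le_of_le_one_right (by positivity) ?_
    have hpy : ξ - p = Kᗮ.starProjection ξ := by
      rw [Submodule.starProjection_orthogonal]; rfl
    rw [hpy, ← hξ]
    exact Submodule.norm_starProjection_apply_le _ _

end PhaseEstimation

/-! ### Choice of sizes and asymptotics. -/

section Parameters

/-- This one rounding supplies `m`, `q` and `k`. Keeping `y ≥ y₀ > 1` bounds `log y` away from zero,
so the additive `log (2a)` is absorbed in `C`; the factor `2` comes from `log 2 > 1/2`. -/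
theorem exists_pow_two_near {a y₀ : ℝ} (ha : 1 ≤ a) (hy₀ : 1 < y₀) :
    ∃ C : ℝ, 0 < C ∧ ∀ y, y₀ ≤ y → ∃ n : ℕ, 1 ≤ n ∧ a * y < 2 ^ n ∧ (2 : ℝ) ^ n ≤ 2 * (a * y) ∧
      (n : ℝ) ≤ C * Real.log y := by
  have hl₀ : 0 < Real.log y₀ := Real.log_pos hy₀
  have hla : 0 < Real.log (2 * a) := Real.log_pos (by linarith)
  refine ⟨2 * (Real.log (2 * a) / Real.log y₀ + 1), by positivity, fun y hy => ?_⟩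
  have hy1 : 1 < y := hy₀.trans_le hy
  have hay : 1 ≤ a * y := by nlinarith
  obtain ⟨n, hn1, hn2⟩ := exists_nat_pow_near hay (one_lt_two (α := ℝ))
  have hn3 : (2 : ℝ) ^ (n + 1) ≤ 2 * (a * y) := by
    rw [pow_succ]
    linarith
  refine ⟨n + 1, by omega, hn2, hn3, ?_⟩
  have hlog := Real.log_le_log (by positivity) hn3
  rw [Real.log_pow, ← mul_assoc, Real.log_mul (by positivity) (by positivity)] at hlog
  have hll : Real.log y₀ ≤ Real.log y := Real.log_le_log (by linarith) hy
  have h1 : Real.log (2 * a) ≤ Real.log (2 * a) / Real.log y₀ * Real.log y := by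
    rw [div_mul_eq_mul_div, le_div_iff₀ hl₀]
    exact mul_le_mul_of_nonneg_left hll hla.le
  have h2 := Real.log_two_gt_d9
  have h3 : (0 : ℝ) ≤ ((n + 1 : ℕ) : ℝ) := by positivity
  nlinarith

theorem isLittleO_log_mul_loglog {δ : ℝ} (hδ : 0 < δ) :
    (fun Δ : ℝ => Real.log (1 / Δ) * Real.log (Real.log (1 / Δ)))
      =o[𝓝[>] 0] fun Δ : ℝ => Real.log (1 / Δ) ^ (1 + δ) := by
  have ht : Tendsto (fun Δ : ℝ => Real.log (1 / Δ)) (𝓝[>] 0) atTop := by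
    simp only [one_div]
    exact Real.tendsto_log_atTop.comp tendsto_inv_nhdsGT_zero
  have h := (isBigO_refl (fun x : ℝ => x) atTop).mul_isLittleO (isLittleO_log_rpow_atTop hδ)
  refine (h.comp_tendsto ht).congr' EventuallyEq.rfl ?_
  filter_upwards [ht.eventually_gt_atTop 0] with Δ hΔ
  rw [Function.comp_apply, Real.rpow_add hΔ, Real.rpow_one]

end Parameters

/-! ### Assembly of the main theorem. -/

theorem mainTheorem8 :
    (∀ η ε₀ Δ₀ : ℝ, 0 < η → 0 < ε₀ → ε₀ < 1 → 0 < Δ₀ → Δ₀ < Real.exp (-1) →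
      ∃ C : ℝ, 0 < C ∧
        ∀ ε Δ : ℝ, 0 < ε → ε ≤ ε₀ → 0 < Δ → Δ ≤ Δ₀ →
          ∃ (q m k e : ℕ) (R : Circuit (PeaQubits q m e)),
            -- `q` phase estimations on `m` qubits each, Fourier transforms of precision `η`
            (q : ℝ) ≤ C * Real.log (1 / ε) ∧
            (m : ℝ) ≤ C * Real.log (1 / Δ) ∧
            AqftPrecision m k η ∧
            ((aqft m k).gateCount : ℝ) ≤ C * (Real.log (1 / Δ) * Real.log (Real.log (1 / Δ))) ∧
            -- the reflection on the ancillas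
            ImplementsZeroReflection R ∧
            (R.gateCount : ℝ) ≤ C * (q * m : ℕ) ∧
            -- total number of ancillas, queries, and gates
            (Fintype.card (PeaQubits q m e) : ℝ) ≤ C * (Real.log (1 / ε) * Real.log (1 / Δ)) ∧
            ((peaReflection k R).queryCount : ℝ) ≤ C * (Real.log (1 / ε) / Δ) ∧
            ((peaReflection k R).gateCount : ℝ) ≤
              C * (Real.log (1 / ε) * Real.log (1 / Δ) * Real.log (Real.log (1 / Δ))) ∧
            -- correctness, for all systems, unitaries and target states
            ∀ (E : Type*) [NormedAddCommGroup E] [InnerProductSpace ℂ E] [FiniteDimensional ℂ E]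
              (U : E ≃ₗᵢ[ℂ] E) (ψ₀ : E), IsGappedTarget U ψ₀ Δ →
              (peaReflection k R).run U (zeroKet (PeaQubits q m e) ψ₀) =
                zeroKet (PeaQubits q m e) ψ₀ ∧
              ∀ ξ : E, ‖ξ‖ = 1 →
                stateNorm ((peaReflection k R).run U (zeroKet (PeaQubits q m e) ξ) -
                  zeroKet (PeaQubits q m e) ((Submodule.span ℂ {ψ₀}).reflection ξ)) ≤ ε) ∧
    -- improvement over a `log (1 / Δ) ^ 2` dependence: the new one is smaller than every power
    -- of `log (1 / Δ)` with exponent above one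
    (∀ δ : ℝ, 0 < δ →
      (fun Δ : ℝ => Real.log (1 / Δ) * Real.log (Real.log (1 / Δ)))
        =o[𝓝[>] 0] fun Δ : ℝ => Real.log (1 / Δ) ^ (1 + δ)) := by
  refine ⟨fun η ε₀ Δ₀ hη hε₀ hε₀1 hΔ₀ hΔ₀e => ?_, fun δ hδ => isLittleO_log_mul_loglog hδ⟩
  have hpi := Real.pi_pos
  have hpi3 := Real.pi_gt_three
  have he1 : Real.exp (-1) < 1 := by
    rw [Real.exp_lt_one_iff]
    norm_num
  have hΔ₀1 : 1 < 1 / Δ₀ := by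
    rw [lt_div_iff₀ hΔ₀]
    linarith
  have hL₀ : 1 < Real.log (1 / Δ₀) := by
    rw [one_div, Real.log_inv]
    have := (Real.log_lt_iff_lt_exp hΔ₀).2 hΔ₀e
    linarith
  have hl₀ : 0 < Real.log (Real.log (1 / Δ₀)) := Real.log_pos hL₀
  -- With `y = 1/Δ`: the lower bound on `2^m` halves each register's factor, the upper bound limits
  -- the queries.
  obtain ⟨Cm, hCm, hm⟩ := exists_pow_two_near (a := 2 * Real.pi) (by linarith) hΔ₀1
  -- With `y = 1/ε`: `2^q > 2/ε` brings the error `2 · 2^(-q)` below `ε`.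
  obtain ⟨Cq, hCq, hq⟩ := exists_pow_two_near (a := 2) (y₀ := 1 / ε₀) one_le_two (by
    rw [lt_div_iff₀ hε₀]
    linarith)
  -- With `y = log (1/Δ)`: since `m ≤ Cm y`, this forces `mπ/2^k ≤ η`. The `+ 1` secures `1 ≤ a`.
  obtain ⟨Ck, hCk, hk⟩ := exists_pow_two_near (a := Cm * Real.pi / η + 1) (by
    have : 0 < Cm * Real.pi / η := by positivity
    linarith) hL₀
  set l₀ := Real.log (Real.log (1 / Δ₀)) with hl₀def
  -- The bound `log log (1/Δ) ≥ l₀ > 0`, due to `Δ₀ < 1/e`, absorbs the `2` in the gate count `m (k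
  -- + 2)`.
  set C₁ := Cm * (Ck + 2 / l₀) with hC₁
  have hC₁0 : 0 < C₁ := by positivity
  -- Four parallel Fourier transforms occur in `W` and `W†`; `17 = 14 + 3` bounds the reflection's
  -- `14qm + 3` gates, and dividing by `l₀` supplies its missing double logarithm.
  set C₂ := 4 * (Cq * C₁) + 17 * (Cq * Cm) / l₀ with hC₂
  have hC₂0 : 0 < C₂ := by positivity
  have hCqm : 0 < Cq * Cm := by positivity
  have hCqpi : 0 < Cq * Real.pi := by positivity
  refine ⟨Cq + Cm + C₁ + 17 + 3 * (Cq * Cm) + 8 * (Cq * Real.pi) + C₂, by positivity,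
    fun ε Δ hε hεε₀ hΔ hΔΔ₀ => ?_⟩
  have hyΔ : 1 / Δ₀ ≤ 1 / Δ := one_div_le_one_div_of_le hΔ hΔΔ₀
  have hyε : 1 / ε₀ ≤ 1 / ε := one_div_le_one_div_of_le hε hεε₀
  have hyL : Real.log (1 / Δ₀) ≤ Real.log (1 / Δ) := Real.log_le_log (by positivity) hyΔ
  have hLL : l₀ ≤ Real.log (Real.log (1 / Δ)) := Real.log_le_log (by positivity) hyL
  obtain ⟨m, hm1, hm2, hm3, hm4⟩ := hm _ hyΔ
  obtain ⟨q, hq1, hq2, hq3, hq4⟩ := hq _ hyε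
  obtain ⟨k, hk1, hk2, hk3, hk4⟩ := hk _ hyL
  set L := Real.log (1 / Δ) with hL
  set M := Real.log L with hM
  set N := Real.log (1 / ε) with hN
  have hL0 : 0 < L := by linarith
  have hM0 : 0 < M := by linarith
  have hN0 : 0 < N := by
    have h1 : (1 : ℝ) ≤ q := by exact_mod_cast hq1
    by_contra h
    have : Cq * N ≤ 0 := mul_nonpos_of_nonneg_of_nonpos hCq.le (not_lt.1 h)
    linarith
  have hsurj : Function.Surjective (finProdFinEquiv.symm : Fin (q * m) → Fin q × Fin m) :=
    finProdFinEquiv.symm.surjective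
  have hqm : (q : ℝ) * m ≤ Cq * Cm * (N * L) := by
    calc (q : ℝ) * m ≤ (Cq * N) * (Cm * L) := by gcongr
      _ = _ := by ring
  have hqm1 : (1 : ℝ) ≤ (q : ℝ) * m := by
    exact_mod_cast Nat.mul_pos hq1 hm1
  have haqft : ((aqft m k).gateCount : ℝ) ≤ C₁ * (L * M) := by
    have h1 : ((aqft m k).gateCount : ℝ) ≤ m * (k + 2) := by exact_mod_cast gateCount_aqft_le m k
    have h2 : (k : ℝ) + 2 ≤ (Ck + 2 / l₀) * M := by
      have : 2 ≤ 2 / l₀ * M := by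
        rw [div_mul_eq_mul_div, le_div_iff₀ hl₀]
        linarith
      linarith
    calc ((aqft m k).gateCount : ℝ) ≤ m * (k + 2) := h1
      _ ≤ (Cm * L) * ((Ck + 2 / l₀) * M) := by gcongr
      _ = C₁ * (L * M) := by rw [hC₁]; ring
  refine ⟨q, m, k, q * m + 1, zeroReflectionCircuit finProdFinEquiv.symm, ?_, ?_, ?_, ?_,
    implementsZeroReflection_zeroReflectionCircuit hsurj, ?_, ?_, ?_, ?_, ?_⟩
  · refine hq4.trans (mul_le_mul_of_nonneg_right ?_ hN0.le)
    linarith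
  · refine hm4.trans (mul_le_mul_of_nonneg_right ?_ hL0.le)
    linarith
  · refine aqftPrecision_of_le ?_
    rw [← mul_div_assoc, div_le_iff₀ (by positivity)]
    have h1 : (Cm * Real.pi / η + 1) * L * η ≤ 2 ^ k * η := by gcongr
    have h2 : (Cm * Real.pi / η + 1) * L * η = Cm * L * Real.pi + L * η := by
      field_simp
    have h3 : (m : ℝ) * Real.pi ≤ Cm * L * Real.pi := by gcongr
    have h4 : 0 < L * η := by positivity
    linarith
  · refine haqft.trans (mul_le_mul_of_nonneg_right ?_ (by positivity))
    linarith
  · rw [gateCount_zeroReflectionCircuit]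
    push_cast
    have h1 : (14 : ℝ) * (q * m) + 3 ≤ 17 * (q * m) := by linarith
    refine h1.trans (mul_le_mul_of_nonneg_right ?_ (by positivity))
    linarith
  · rw [Fintype.card_sum, Fintype.card_prod, Fintype.card_fin, Fintype.card_fin, Fintype.card_fin]
    push_cast
    have h1 : (q : ℝ) * m + (q * m + 1) ≤ 3 * (Cq * Cm) * (N * L) := by linarith
    refine h1.trans (mul_le_mul_of_nonneg_right ?_ (by positivity))
    linarith
  · have h1 : ((peaReflection k (zeroReflectionCircuit
        (finProdFinEquiv.symm : Fin (q * m) → Fin q × Fin m))).queryCount : ℝ) ≤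
        2 * (q * 2 ^ m) := by
      exact_mod_cast queryCount_peaReflection_le k (queryCount_zeroReflectionCircuit _)
    have h2 : 2 * ((q : ℝ) * 2 ^ m) ≤ 2 * ((Cq * N) * (2 * (2 * Real.pi * (1 / Δ)))) := by gcongr
    have h3 : 2 * ((Cq * N) * (2 * (2 * Real.pi * (1 / Δ)))) = 8 * (Cq * Real.pi) * (N / Δ) := by
      ring
    refine (h1.trans (h2.trans_eq h3)).trans (mul_le_mul_of_nonneg_right ?_ (by positivity))
    linarith
  · rw [gateCount_peaReflection, gateCount_zeroReflectionCircuit]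
    push_cast
    have h1 : (q : ℝ) * (aqft m k).gateCount ≤ (Cq * N) * (C₁ * (L * M)) := by gcongr
    have h2 : 17 * ((q : ℝ) * m) ≤ 17 * (Cq * Cm) / l₀ * (N * L * M) := by
      have h3 : N * L * l₀ ≤ N * L * M := by gcongr
      calc 17 * ((q : ℝ) * m) ≤ 17 * (Cq * Cm * (N * L)) := by linarith
        _ = 17 * (Cq * Cm) / l₀ * (N * L * l₀) := by field_simp
        _ ≤ _ := by gcongr
    have h4 : (4 : ℝ) * (q * (aqft m k).gateCount) + (14 * (q * m) + 3) ≤ C₂ * (N * L * M) := by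
      rw [hC₂, add_mul]
      have : (Cq * N) * (C₁ * (L * M)) = Cq * C₁ * (N * L * M) := by ring
      linarith
    refine h4.trans (mul_le_mul_of_nonneg_right ?_ (by positivity))
    linarith
  · intro E _ _ _ U ψ₀ hU
    have hmΔ : 2 * Real.pi / Δ ≤ 2 ^ m := by
      rw [div_eq_mul_one_div]
      exact hm2.le
    obtain ⟨h1, h2⟩ := peaReflection_correct U k
      (fun ψ hψ => run_zeroReflectionCircuit U hsurj ψ hψ) hΔ hmΔ hU
    refine ⟨h1, fun ξ hξ => (h2 ξ hξ).trans ?_⟩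
    rw [one_div_pow, mul_one_div, div_le_iff₀ (by positivity)]
    have h3 : 2 * (1 / ε) * ε < 2 ^ q * ε := by gcongr
    have h4 : 2 * (1 / ε) * ε = 2 := by field_simp
    linarith
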